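/- **Setting.** Let $C\in\mathbb{R}^{N\times N}_+$, let $r,c$ lie in the simplex $S_N(1)=\{s\in\mathbb{R}^N_+:\sum_i s_i=1\}$, and let $\mathcal U(r,c)=\{X\in\mathbb{R}_+^{N\times N}: X\mathbf 1=r,\ X^T\mathbf 1=c\}$. Write $\|C\|_\infty=\max_{i,j}|C^{ij}|$, $\|X\|_1=\sum_{i,j}|X^{ij}|$, $\|\cdot\|$ for the Euclidean norm on $\mathbb{R}^{2N}$, $\mathbf A X=(X\mathbf 1,X^T\mathbf 1)$, $b=(r,c)$, and for $\gamma>0$ $$f(X)=\langle C,X\rangle+\gamma\langle X,\ln X\rangle,\qquad \varphi(u,v)=\gamma\big(\ln(\mathbf 1^TB(u,v)\mathbf 1)-\langle u,r\rangle-\langle v,c\rangle\big),$$ $$B(u,v)^{ij}=e^{u^i+v^j-C^{ij}/\gamma},\qquad x(u,v)=B(u,v)/(\mathbf 1^TB(u,v)\mathbf 1).$$ Here $f$ is the entropy-regularized optimal transport objective on $\mathcal U(r,c)$ and $\varphi$ is its dual (to be minimized over $\mathbb{R}^{2N}$). **Accelerated Sinkhorn** with initial Lipschitz estimate $L_0>0$.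 Start with $a_0=0$, $\eta^0=\zeta^0=0\in\mathbb{R}^{2N}$ ($\hat x^0$ is irrelevant). In iteration $k\ge0$ try $L_{k+1}=L_k/2,\,L_k,\,2L_k,\dots$ in this order. For each candidate put $$a_{k+1}=\tfrac1{2L_{k+1}}+\sqrt{\tfrac1{4L_{k+1}^2}+a_k^2\tfrac{L_k}{L_{k+1}}},\quad \tau_k=\tfrac1{a_{k+1}L_{k+1}},\quad \lambda^k=\tau_k\zeta^k+(1-\tau_k)\eta^k,$$ choose a block ($u$ or $v$) with the largest norm of the partial gradient of $\varphi$ at $\lambda^k=(u,v)$, and let $\eta^{k+1}$ be $\lambda^k$ with that block replaced by $u+\ln r-\ln(B(u,v)\mathbf 1)$, respectively $v+\ln c-\ln(B(u,v)^T\mathbf 1)$. Accept the first candidate with $\varphi(\eta^{k+1})\le\varphi(\lambda^k)-\|\nabla\varphi(\lambda^k)\|^2/(2L_{k+1})$, and set $$\zeta^{k+1}=\zeta^k-a_{k+1}\nabla\varphi(\lambda^k),\qquad \hat x^{k+1}=\frac{a_{k+1}x(\lambda^k)+L_ka_k^2\hat x^k}{L_{k+1}a_{k+1}^2}.$$ **(1)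 Rates.** Suppose that $r_i,c_j>0$ for all $i,j$, that $\gamma>0$, and that $0<L_0\le16\gamma$. Then Accelerated Sinkhorn is well defined (the trial of candidates always stops), $f$ has a unique minimizer $x^*$ on $\mathcal U(r,c)$, and for every sequence generated by the algorithm (whatever the choice of block in case of ties) and every $k\ge1$, with $\rho=\|C\|_\infty-\frac\gamma2\ln\min_{i,j}\{r_i,c_j\}$, $$\|\mathbf A\hat x^k-b\|\le\frac{64\sqrt{N/2}\,\rho}{\gamma k^2},\qquad |\varphi(\eta^k)+f(\hat x^k)|\le\frac{32N\rho^2}{\gamma k^2},\qquad \|\hat x^k-x^*\|_1\le\frac{16\sqrt{N/2}\,\rho}{\gamma k}.$$ **(2) Complexity.** Let $N\ge2$, $r,c\in S_N(1)$ (zero entries are allowed), $0<\varepsilon\le\|C\|_\infty$. Consider the following algorithm. Put $\gamma=\varepsilon/(4\ln N)$, $\varepsilon'=\varepsilon/(8\|C\|_\infty)$ and choose $\tilde r,\tilde c\in S_N(1)$ with $\|\tilde r-r\|_1,\|\tilde c-c\|_1\le\varepsilon'/4$ and all entries at least $\varepsilon'/(8N)$; for example $(\tilde r,\tilde c)=(1-\frac{\varepsilon'}8)\big((r,c)+\frac{\varepsilon'}{N(8-\varepsilon')}(\mathbf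 1,\mathbf 1)\big)$, which does satisfy these conditions. Run Accelerated Sinkhorn for $C,\tilde r,\tilde c,\gamma$ from $L_0$. After each iteration $k=1,2,\dots$, round $\hat x^k$ to a matrix $\hat X\in\mathcal U(r,c)$ as follows: multiply row $i$ of $F=\hat x^k$ by $\min\{r_i/(F\mathbf 1)_i,1\}$ for all $i$ to get $F'$; multiply column $j$ of $F'$ by $\min\{c_j/(F'^T\mathbf 1)_j,1\}$ for all $j$ to get $F''$; with $e=r-F''\mathbf 1$, $e'=c-F''^T\mathbf 1$, output $F''+ee'^T/\|e\|_1$ (or $F''$ if $e=0$). Stop and return $\hat X$ as soon as $\langle C,\hat X-\hat x^k\rangle\le\varepsilon/6$ and $f(\hat x^k)+\varphi(\eta^k)\le\varepsilon/6$ (with $\varphi$ formed from $\tilde r,\tilde c$). For every $\theta>0$ there is a constant $K$, depending only on $\theta$, such that for all such $N,C,r,c,\varepsilon$, all $L_0$ with $\theta\gamma\le L_0\le16\gamma$, and every admissible choice of $\tilde r,\tilde c$, the algorithm stops and returns $\hat X\in\mathcal U(r,c)$ with $$\langle C,\hat X\rangle\le\min_{X\in\mathcal U(r,c)}\langle C,X\rangle+\varepsilon,$$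 after at most $$K\,\frac{N^{5/2}\sqrt{\ln N}\,\|C\|_\infty}{\varepsilon}$$ arithmetic operations, not counting the computation of $\tilde r,\tilde c$; with the explicit $\tilde r,\tilde c$ above, that computation is included in the bound. An arithmetic operation is an addition, subtraction, multiplication, division, comparison, absolute value, minimum, maximum, square root, exponential or logarithm of real numbers. Ties between blocks in this implementation are broken in favour of $u$. -/

import Mathlib

open scoped Matrix

noncomputable section

namespace AccSinkhorn

/-! ### Regularized and unregularized optimal transport -/

/-- The probability simplex `S_N(1)`. -/
def IsHistogram {N : ℕ} (s : Fin N → ℝ) : Prop :=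
  (∀ i, 0 ≤ s i) ∧ ∑ i, s i = 1

/-- The transport polytope `U(r, c)`. -/
def transportPolytope {N : ℕ} (r c : Fin N → ℝ) : Set (Matrix (Fin N) (Fin N) ℝ) :=
  {X | (∀ i j, 0 ≤ X i j) ∧ X *ᵥ 1 = r ∧ Xᵀ *ᵥ 1 = c}

/-- The Frobenius product `⟨A, B⟩`. -/
def frob {N : ℕ} (A B : Matrix (Fin N) (Fin N) ℝ) : ℝ := ∑ i, ∑ j, A i j * B i j

/-- `‖C‖_∞`, the largest absolute value of an entry. -/
def maxAbs {N : ℕ} (C : Matrix (Fin N) (Fin N) ℝ) : ℝ := ⨆ p : Fin N × Fin N, |C p.1 p.2|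

/-- The entrywise norm `‖X‖₁`. -/
def l1Norm {N : ℕ} (X : Matrix (Fin N) (Fin N) ℝ) : ℝ := ∑ i, ∑ j, |X i j|

/-- `min_{i,j} {r_i, c_j}`. -/
def minEntry {N : ℕ} (r c : Fin N → ℝ) : ℝ := min (⨅ i, r i) (⨅ j, c j)

/-- The entropy-regularized objective `f(X) = ⟨C, X⟩ + γ ⟨X, ln X⟩` (with `0 ln 0 = 0`). -/
def regObj {N : ℕ} (C : Matrix (Fin N) (Fin N) ℝ) (γ : ℝ) (X : Matrix (Fin N) (Fin N) ℝ) : ℝ :=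
  frob C X + γ * frob X (X.map Real.log)

/-- `X` solves the entropy-regularized problem `f(X) → min`, `X ∈ U(r, c)`. -/
def IsRegSolution {N : ℕ} (C : Matrix (Fin N) (Fin N) ℝ) (r c : Fin N → ℝ) (γ : ℝ)
    (X : Matrix (Fin N) (Fin N) ℝ) : Prop :=
  X ∈ transportPolytope r c ∧ IsMinOn (regObj C γ) (transportPolytope r c) X

/-- `X` is an `ε`-approximate solution of the unregularized problem on `U(r, c)`. -/
def IsApproxPlan {N : ℕ} (C : Matrix (Fin N) (Fin N) ℝ) (r c : Fin N → ℝ) (ε : ℝ)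
    (X : Matrix (Fin N) (Fin N) ℝ) : Prop :=
  X ∈ transportPolytope r c ∧ ∀ Y ∈ transportPolytope r c, frob C X ≤ frob C Y + ε

/-! ### The dual problem in softmax form -/

/-- The dual space `ℝ^{2N}` with its Euclidean norm; the coordinates `Sum.inl i` are those of
the block `u`, the coordinates `Sum.inr j` those of the block `v`. -/
abbrev Dual (N : ℕ) : Type := EuclideanSpace ℝ (Fin N ⊕ Fin N)

/-- The dual point with blocks `u` and `v`. -/
def mkDual {N : ℕ} (u v : Fin N → ℝ) : Dual N := WithLp.toLp 2 (Sum.elim u v)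

/-- The constraint operator `𝐀 X = (X 1, Xᵀ 1)`. -/
def marginals {N : ℕ} (X : Matrix (Fin N) (Fin N) ℝ) : Dual N := mkDual (X *ᵥ 1) (Xᵀ *ᵥ 1)

/-- `B(u, v)^{ij} = exp(u^i + v^j - C^{ij} / γ)`. -/
def kernelB {N : ℕ} (C : Matrix (Fin N) (Fin N) ℝ) (γ : ℝ) (p : Dual N) :
    Matrix (Fin N) (Fin N) ℝ :=
  Matrix.of fun i j => Real.exp (p (Sum.inl i) + p (Sum.inr j) - C i j / γ)

/-- `1ᵀ B(u, v) 1`. -/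
def mass {N : ℕ} (C : Matrix (Fin N) (Fin N) ℝ) (γ : ℝ) (p : Dual N) : ℝ :=
  ∑ i, ∑ j, kernelB C γ p i j

/-- The dual objective `φ(u, v) = γ (ln (1ᵀ B(u, v) 1) - ⟨u, r⟩ - ⟨v, c⟩)`. -/
def dualObj {N : ℕ} (C : Matrix (Fin N) (Fin N) ℝ) (r c : Fin N → ℝ) (γ : ℝ) (p : Dual N) : ℝ :=
  γ * (Real.log (mass C γ p) - ∑ i, p (Sum.inl i) * r i - ∑ j, p (Sum.inr j) * c j)

/-- The primal point `x(u, v) = (1ᵀ B(u, v) 1)⁻¹ B(u, v)`. -/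
def primalPoint {N : ℕ} (C : Matrix (Fin N) (Fin N) ℝ) (γ : ℝ) (p : Dual N) :
    Matrix (Fin N) (Fin N) ℝ :=
  (mass C γ p)⁻¹ • kernelB C γ p

/-! ### Accelerated Sinkhorn -/

/-- The two blocks of dual variables. -/
inductive Block : Type
  | u
  | v

/-- Squared Euclidean norm of one block of a dual vector. -/
def blockSq {N : ℕ} (g : Dual N) : Block → ℝ
  | .u => ∑ i, g (Sum.inl i) ^ 2
  | .v => ∑ j, g (Sum.inr j) ^ 2

/-- `b ∈ argmax_{i ∈ {1, 2}} ‖∇_i φ(p)‖²`. -/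
def IsGreedyBlock {N : ℕ} (C : Matrix (Fin N) (Fin N) ℝ) (r c : Fin N → ℝ) (γ : ℝ) (p : Dual N)
    (b : Block) : Prop :=
  ∀ b', blockSq (gradient (dualObj C r c γ) p) b' ≤ blockSq (gradient (dualObj C r c γ) p) b

/-- The Sinkhorn update of one block. -/
def blockUpdate {N : ℕ} (C : Matrix (Fin N) (Fin N) ℝ) (r c : Fin N → ℝ) (γ : ℝ) (p : Dual N) :
    Block → Dual N
  | .u => mkDual
      (fun i => p (Sum.inl i) + Real.log (r i) - Real.log ((kernelB C γ p *ᵥ 1) i))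
      (fun j => p (Sum.inr j))
  | .v => mkDual
      (fun i => p (Sum.inl i))
      (fun j => p (Sum.inr j) + Real.log (c j) - Real.log (((kernelB C γ p)ᵀ *ᵥ 1) j))

/-- The data `L_k, a_k, ζ^k, η^k, x̂^k` that the algorithm keeps after `k` iterations. -/
structure State (N : ℕ) where
  L : ℝ
  a : ℝ
  ζ : Dual N
  η : Dual N
  xhat : Matrix (Fin N) (Fin N) ℝ

/-- The initial data. The value of `x̂⁰` plays no role, since it enters with weight
`L_0 a_0² = 0`. -/
def State.init (N : ℕ) (L₀ : ℝ) : State N := ⟨L₀, 0, 0, 0, 0⟩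

/-- The step size `a_{k+1}` that belongs to the candidate `L'` for `L_{k+1}`. -/
def State.nextA {N : ℕ} (s : State N) (L' : ℝ) : ℝ :=
  1 / (2 * L') + √(1 / (4 * L' ^ 2) + s.a ^ 2 * (s.L / L'))

/-- The point `λ^k = τ_k ζ^k + (1 - τ_k) η^k`, `τ_k = 1 / (a_{k+1} L_{k+1})`, that belongs to the
candidate `L'` for `L_{k+1}`. -/
def State.lam {N : ℕ} (s : State N) (L' : ℝ) : Dual N :=
  (1 / (s.nextA L' * L')) • s.ζ + (1 - 1 / (s.nextA L' * L')) • s.η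

/-- The data after the iteration, if the candidate `L'` is accepted and `b` is the block that was
updated. -/
def State.next {N : ℕ} (C : Matrix (Fin N) (Fin N) ℝ) (r c : Fin N → ℝ) (γ : ℝ) (s : State N)
    (L' : ℝ) (b : Block) : State N where
  L := L'
  a := s.nextA L'
  ζ := s.ζ - s.nextA L' • gradient (dualObj C r c γ) (s.lam L')
  η := blockUpdate C r c γ (s.lam L') b
  xhat := (1 / (L' * s.nextA L' ^ 2)) •
    (s.nextA L' • primalPoint C γ (s.lam L') + (s.L * s.a ^ 2) • s.xhat)

/-- The acceptance test `φ(η^{k+1}) ≤ φ(λ^k) - ‖∇φ(λ^k)‖² / (2 L_{k+1})`. -/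
def State.Accepts {N : ℕ} (C : Matrix (Fin N) (Fin N) ℝ) (r c : Fin N → ℝ) (γ : ℝ) (s : State N)
    (L' : ℝ) (b : Block) : Prop :=
  dualObj C r c γ (s.next C r c γ L' b).η ≤
    dualObj C r c γ (s.lam L') - ‖gradient (dualObj C r c γ) (s.lam L')‖ ^ 2 / (2 * L')

/-- One iteration: the candidates `L_k / 2, L_k, 2 L_k, …` are tried in this order, each with some
block of largest partial gradient, until the first one is accepted. -/
def IsIteration {N : ℕ} (C : Matrix (Fin N) (Fin N) ℝ) (r c : Fin N → ℝ) (γ : ℝ)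
    (s s' : State N) : Prop :=
  ∃ (n : ℕ) (b : ℕ → Block),
    (∀ m ≤ n, IsGreedyBlock C r c γ (s.lam (2 ^ m * (s.L / 2))) (b m)) ∧
    (∀ m < n, ¬ s.Accepts C r c γ (2 ^ m * (s.L / 2)) (b m)) ∧
    s.Accepts C r c γ (2 ^ n * (s.L / 2)) (b n) ∧
    s' = s.next C r c γ (2 ^ n * (s.L / 2)) (b n)

/-- A sequence of data generated by Accelerated Sinkhorn from the initial estimate `L₀`. -/
def IsRun {N : ℕ} (C : Matrix (Fin N) (Fin N) ℝ) (r c : Fin N → ℝ) (γ L₀ : ℝ)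
    (s : ℕ → State N) : Prop :=
  s 0 = State.init N L₀ ∧ ∀ k, IsIteration C r c γ (s k) (s (k + 1))

/-! ### Counting arithmetic operations

A computation with real numbers together with the number of its arithmetic operations. One
operation is an addition, subtraction, multiplication, division, comparison, absolute value,
minimum or maximum of two numbers, square root, exponential or logarithm. Constants, the input and
moving data are free. -/

structure Costed (α : Type) where
  val : α
  ops : ℕ

instance : Monad Costed where
  pure x := ⟨x, 0⟩
  bind x f := ⟨(f x.val).val, x.ops + (f x.val).ops⟩

namespace Costed

def add (x y : ℝ) : Costed ℝ := ⟨x + y, 1⟩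
def sub (x y : ℝ) : Costed ℝ := ⟨x - y, 1⟩
def mul (x y : ℝ) : Costed ℝ := ⟨x * y, 1⟩
def div (x y : ℝ) : Costed ℝ := ⟨x / y, 1⟩
def sqrt (x : ℝ) : Costed ℝ := ⟨√x, 1⟩
def exp (x : ℝ) : Costed ℝ := ⟨Real.exp x, 1⟩
def log (x : ℝ) : Costed ℝ := ⟨Real.log x, 1⟩
def min2 (x y : ℝ) : Costed ℝ := ⟨min x y, 1⟩

open Classical in
/-- The comparison `x ≤ y`. -/
def le (x y : ℝ) : Costed Bool := ⟨decide (x ≤ y), 1⟩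

/-- Compute every entry of a vector. -/
def vec {N : ℕ} (f : Fin N → Costed ℝ) : Costed (Fin N → ℝ) :=
  ⟨fun i => (f i).val, ∑ i, (f i).ops⟩

/-- Compute every entry of a matrix. -/
def mat {N : ℕ} (f : Fin N → Fin N → Costed ℝ) : Costed (Matrix (Fin N) (Fin N) ℝ) :=
  ⟨Matrix.of fun i j => (f i j).val, ∑ i, ∑ j, (f i j).ops⟩

/-- Sum of the entries of a vector, with `N` additions. -/
def sum {N : ℕ} (x : Fin N → ℝ) : Costed ℝ := ⟨∑ i, x i, N⟩

/-- `‖C‖_∞`, with `N²` absolute values and `N²` comparisons. -/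
def maxAbs {N : ℕ} (C : Matrix (Fin N) (Fin N) ℝ) : Costed ℝ :=
  ⟨AccSinkhorn.maxAbs C, N * N + N * N⟩

def dot {N : ℕ} (x y : Fin N → ℝ) : Costed ℝ := do
  let z ← vec fun i => mul (x i) (y i)
  sum z

def rowSums {N : ℕ} (X : Matrix (Fin N) (Fin N) ℝ) : Costed (Fin N → ℝ) :=
  vec fun i => sum fun j => X i j

def colSums {N : ℕ} (X : Matrix (Fin N) (Fin N) ℝ) : Costed (Fin N → ℝ) :=
  vec fun j => sum fun i => X i j

def frob {N : ℕ} (A B : Matrix (Fin N) (Fin N) ℝ) : Costed ℝ := do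
  let Z ← mat fun i j => mul (A i j) (B i j)
  let R ← rowSums Z
  sum R

/-! ### The operations of Accelerated Sinkhorn -/

def kernelB {N : ℕ} (C : Matrix (Fin N) (Fin N) ℝ) (γ : ℝ) (p : Dual N) :
    Costed (Matrix (Fin N) (Fin N) ℝ) :=
  mat fun i j => do
    let t ← add (p (Sum.inl i)) (p (Sum.inr j))
    let q ← div (C i j) γ
    let d ← sub t q
    exp d

def dualObj {N : ℕ} (C : Matrix (Fin N) (Fin N) ℝ) (r c : Fin N → ℝ) (γ : ℝ) (p : Dual N) :
    Costed ℝ := do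
  let B ← kernelB C γ p
  let R ← rowSums B
  let S ← sum R
  let l ← log S
  let x ← dot (fun i => p (Sum.inl i)) r
  let y ← dot (fun j => p (Sum.inr j)) c
  let d ← sub l x
  let e ← sub d y
  mul γ e

def regObj {N : ℕ} (C : Matrix (Fin N) (Fin N) ℝ) (γ : ℝ) (X : Matrix (Fin N) (Fin N) ℝ) :
    Costed ℝ := do
  let t ← frob C X
  let Y ← mat fun i j => log (X i j)
  let h ← frob X Y
  let g ← mul γ h
  add t g

/-- `x p + y q` for dual points `p`, `q`. -/
def combine {N : ℕ} (x y : ℝ) (p q : Dual N) : Costed (Dual N) := do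
  let f ← vec fun i => do
    let s ← mul x (p (Sum.inl i))
    let t ← mul y (q (Sum.inl i))
    add s t
  let g ← vec fun j => do
    let s ← mul x (p (Sum.inr j))
    let t ← mul y (q (Sum.inr j))
    add s t
  return mkDual f g

/-- The step size `a_{k+1}` that belongs to the candidate `L'`. -/
def nextA {N : ℕ} (s : State N) (L' : ℝ) : Costed ℝ := do
  let twoL ← mul 2 L'
  let h ← div 1 twoL
  let LL ← mul L' L'
  let fourLL ← mul 4 LL
  let q ← div 1 fourLL
  let aa ← mul s.a s.a
  let ratio ← div s.L L'
  let w ← mul aa ratio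
  let rad ← add q w
  let root ← sqrt rad
  add h root

/-- The extrapolated point `λ^k` for the step size `a'` and the candidate `L'`. -/
def lam {N : ℕ} (s : State N) (L' a' : ℝ) : Costed (Dual N) := do
  let aL ← mul a' L'
  let τ ← div 1 aL
  let τ' ← sub 1 τ
  combine τ τ' s.ζ s.η

/-- The gradient `∇φ = γ (B 1 / (1ᵀ B 1) - r, Bᵀ 1 / (1ᵀ B 1) - c)`. -/
def grad {N : ℕ} (C : Matrix (Fin N) (Fin N) ℝ) (r c : Fin N → ℝ) (γ : ℝ) (p : Dual N) :
    Costed (Dual N) := do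
  let B ← kernelB C γ p
  let R ← rowSums B
  let K ← colSums B
  let S ← sum R
  let gu ← vec fun i => do
    let x ← div (R i) S
    let d ← sub x (r i)
    mul γ d
  let gv ← vec fun j => do
    let x ← div (K j) S
    let d ← sub x (c j)
    mul γ d
  return mkDual gu gv

def blockSq {N : ℕ} (g : Dual N) : Block → Costed ℝ
  | .u => dot (fun i => g (Sum.inl i)) (fun i => g (Sum.inl i))
  | .v => dot (fun j => g (Sum.inr j)) (fun j => g (Sum.inr j))

/-- The Sinkhorn update of one block. -/
def blockUpdate {N : ℕ} (C : Matrix (Fin N) (Fin N) ℝ) (r c : Fin N → ℝ) (γ : ℝ) (p : Dual N) :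
    Block → Costed (Dual N)
  | .u => do
    let B ← kernelB C γ p
    let R ← rowSums B
    let u' ← vec fun i => do
      let x ← log (r i)
      let y ← log (R i)
      let z ← add (p (Sum.inl i)) x
      sub z y
    return mkDual u' fun j => p (Sum.inr j)
  | .v => do
    let B ← kernelB C γ p
    let K ← colSums B
    let v' ← vec fun j => do
      let x ← log (c j)
      let y ← log (K j)
      let z ← add (p (Sum.inr j)) x
      sub z y
    return mkDual (fun i => p (Sum.inl i)) v'

/-- The averaged primal point `(a' x(p) + L_k a_k² x̂^k) / (L' a'²)`. -/
def average {N : ℕ} (C : Matrix (Fin N) (Fin N) ℝ) (γ : ℝ) (s : State N) (L' a' : ℝ)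
    (p : Dual N) : Costed (Matrix (Fin N) (Fin N) ℝ) := do
  let B ← kernelB C γ p
  let R ← rowSums B
  let S ← sum R
  let sq ← mul a' a'
  let A' ← mul L' sq
  let aa ← mul s.a s.a
  let A ← mul s.L aa
  mat fun i j => do
    let x ← div (B i j) S
    let y ← mul a' x
    let z ← mul A (s.xhat i j)
    let t ← add y z
    div t A'

/-- One pass through the inner loop of Accelerated Sinkhorn with the candidate `L'`: the new data,
and whether `L'` is accepted. A tie between the blocks is broken in favour of `u`. -/
def trial {N : ℕ} (C : Matrix (Fin N) (Fin N) ℝ) (r c : Fin N → ℝ) (γ : ℝ) (s : State N)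
    (L' : ℝ) : Costed (State N × Bool) := do
  let a' ← nextA s L'
  let p ← lam s L' a'
  let g ← grad C r c γ p
  let nu ← blockSq g .u
  let nv ← blockSq g .v
  let useU ← le nv nu
  let η' ← blockUpdate C r c γ p (bif useU then .u else .v)
  let na ← sub 0 a'
  let ζ' ← combine 1 na s.ζ g
  let φη ← dualObj C r c γ η'
  let φp ← dualObj C r c γ p
  let normSq ← add nu nv
  let twoL ← mul 2 L'
  let dec ← div normSq twoL
  let target ← sub φp dec
  let ok ← le φη target
  let X ← average C γ s L' a' p
  return (⟨L', a', ζ', η', X⟩, ok)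

/-! ### Rounding to the transport polytope and the overall algorithm -/

/-- Rounding of a matrix `F` to `U(r, c)`: the rows, and then the columns, that are too heavy are
scaled down, and a rank-one correction restores the marginals. -/
def round {N : ℕ} (r c : Fin N → ℝ) (F : Matrix (Fin N) (Fin N) ℝ) :
    Costed (Matrix (Fin N) (Fin N) ℝ) := do
  let R ← rowSums F
  let x ← vec fun i => do
    let q ← div (r i) (R i)
    min2 q 1
  let F' ← mat fun i j => mul (x i) (F i j)
  let K ← colSums F'
  let y ← vec fun j => do
    let q ← div (c j) (K j)
    min2 q 1
  let F'' ← mat fun i j => mul (F' i j) (y j)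
  let R'' ← rowSums F''
  let K'' ← colSums F''
  let er ← vec fun i => sub (r i) (R'' i)
  let ec ← vec fun j => sub (c j) (K'' j)
  let aer ← vec fun i => ⟨|er i|, 1⟩
  let n ← sum aer
  let exact ← le n 0
  if exact then
    return F''
  else
    mat fun i j => do
      let t ← mul (er i) (ec j)
      let q ← div t n
      add (F'' i j) q

/-- The state of the overall algorithm: the data of Accelerated Sinkhorn and the current candidate
for the next `L`. -/
structure Config (N : ℕ) where
  state : State N
  cand : ℝ

/-- One step of the main loop of the overall algorithm, for the perturbed marginals `r'`, `c'`:
a pass through the inner loop of Accelerated Sinkhorn and, if that completes an iteration, the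
rounding of `x̂_k` to `U(r, c)` followed by the stopping test
`⟨C, X̂ - x̂_k⟩ ≤ ε / 6` and `f(x̂_k) + φ(η_k) ≤ ε / 6`.
The result is the next state, or the matrix that the algorithm returns. -/
def mainStep {N : ℕ} (C : Matrix (Fin N) (Fin N) ℝ) (r c : Fin N → ℝ) (ε γ : ℝ)
    (r' c' : Fin N → ℝ) (z : Config N) :
    Costed (Config N ⊕ Matrix (Fin N) (Fin N) ℝ) := do
  let w ← trial C r' c' γ z.state z.cand
  if w.2 then
    let X ← round r c w.1.xhat
    let D ← mat fun i j => sub (X i j) (w.1.xhat i j)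
    let d ← frob C D
    let f ← regObj C γ w.1.xhat
    let φ ← dualObj C r' c' γ w.1.η
    let gap ← add f φ
    let tol ← div ε 6
    let test₁ ← le d tol
    let test₂ ← le gap tol
    if test₁ && test₂ then
      return Sum.inr X
    else
      let L' ← div w.1.L 2
      return Sum.inl ⟨w.1, L'⟩
  else
    let L' ← mul 2 z.cand
    return Sum.inl ⟨z.state, L'⟩

/-- The loop with body `step`, entered at `s`, ends with the result `b` after exactly `t`
arithmetic operations. -/
inductive LoopReturns {σ β : Type} (step : σ → Costed (σ ⊕ β)) : σ → β → ℕ → Prop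
  | done (s : σ) (b : β) (h : (step s).val = Sum.inr b) : LoopReturns step s b (step s).ops
  | next (s s' : σ) (b : β) (t : ℕ) (h : (step s).val = Sum.inl s')
      (h' : LoopReturns step s' b t) : LoopReturns step s b ((step s).ops + t)

/-- The perturbed marginals `(r', c') = (1 - ε'/8) ((r, c) + ε' / (N (8 - ε')) (1, 1))` with
`ε' = ε / (8 ‖C‖_∞)`. -/
def perturb {N : ℕ} (C : Matrix (Fin N) (Fin N) ℝ) (r c : Fin N → ℝ) (ε : ℝ) :
    Costed ((Fin N → ℝ) × (Fin N → ℝ)) := do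
  let M ← maxAbs C
  let M8 ← mul 8 M
  let ε' ← div ε M8
  let e8 ← div ε' 8
  let w ← sub 1 e8
  let d ← sub 8 ε'
  let Nd ← mul (N : ℝ) d
  let δ ← div ε' Nd
  let r' ← vec fun i => do
    let x ← add (r i) δ
    mul w x
  let c' ← vec fun j => do
    let x ← add (c j) δ
    mul w x
  return (r', c')

/-- The computation of `γ = ε / (4 ln N)`. -/
def gammaOf (N : ℕ) (ε : ℝ) : Costed ℝ := do
  let l ← log (N : ℝ)
  let d ← mul 4 l
  div ε d

/-- Everything that precedes the main loop: `γ`, the perturbed marginals, which are obtained by the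
computation `P`, and the first candidate `L₀ / 2`. -/
def setup {N : ℕ} (ε L₀ : ℝ) (P : Costed ((Fin N → ℝ) × (Fin N → ℝ))) :
    Costed (ℝ × ((Fin N → ℝ) × (Fin N → ℝ)) × Config N) := do
  let γ ← gammaOf N ε
  let m ← P
  let L' ← div L₀ 2
  return (γ, m, ⟨State.init N L₀, L'⟩)

end Costed

/-- The perturbed marginals `(r', c')` are admissible: histograms with
`‖r' - r‖₁ ≤ ε'/4`, `‖c' - c‖₁ ≤ ε'/4`, and entries at least `ε'/(8N)`,
where `ε' = ε / (8 ‖C‖_∞)`. -/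
def IsAdmissible {N : ℕ} (C : Matrix (Fin N) (Fin N) ℝ) (r c : Fin N → ℝ) (ε : ℝ)
    (m : (Fin N → ℝ) × (Fin N → ℝ)) : Prop :=
  IsHistogram m.1 ∧ IsHistogram m.2 ∧
  ∑ i, |m.1 i - r i| ≤ ε / (8 * maxAbs C) / 4 ∧
  ∑ j, |m.2 j - c j| ≤ ε / (8 * maxAbs C) / 4 ∧
  (∀ i, ε / (8 * maxAbs C) / (8 * N) ≤ m.1 i) ∧
  (∀ j, ε / (8 * maxAbs C) / (8 * N) ≤ m.2 j)

/-- Approximate OT by Accelerated Sinkhorn, on the input `C, r, c`, with accuracy `ε`, initial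
estimate `L₀`, and with the perturbed marginals computed by `P`, returns the matrix `X` after
exactly `t` arithmetic operations. -/
def AlgorithmReturns {N : ℕ} (C : Matrix (Fin N) (Fin N) ℝ) (r c : Fin N → ℝ) (ε L₀ : ℝ)
    (P : Costed ((Fin N → ℝ) × (Fin N → ℝ))) (X : Matrix (Fin N) (Fin N) ℝ) (t : ℕ) : Prop :=
  ∃ t' : ℕ,
    Costed.LoopReturns
      (Costed.mainStep C r c ε (Costed.setup ε L₀ P).val.1
        (Costed.setup ε L₀ P).val.2.1.1 (Costed.setup ε L₀ P).val.2.1.2)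
      (Costed.setup ε L₀ P).val.2.2 X t' ∧
    t = (Costed.setup ε L₀ P).ops + t'

/-- The algorithm returns an `ε`-approximate solution of the unregularized problem within `T`
arithmetic operations. -/
def SolvesWithin {N : ℕ} (C : Matrix (Fin N) (Fin N) ℝ) (r c : Fin N → ℝ) (ε L₀ : ℝ)
    (P : Costed ((Fin N → ℝ) × (Fin N → ℝ))) (T : ℝ) : Prop :=
  ∃ (X : Matrix (Fin N) (Fin N) ℝ) (t : ℕ),
    AlgorithmReturns C r c ε L₀ P X t ∧ IsApproxPlan C r c ε X ∧ (t : ℝ) ≤ T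

end AccSinkhorn

end

/-! The duality side rests on one identity, `regObj_add_dualObj`: for a joint distribution X, f(X) +
φ(y) − γ⟨y, 𝐀X − b⟩ = γ KL(X ‖ x(y)). Nonnegativity of KL gives weak duality and, at X = x(p),
convexity of φ in tangent form. Pinsker's inequality gives uniqueness of the regularized plan and
turns a small gap into closeness in the entrywise 1-norm.

A Sinkhorn update of a block lowers φ by γ times the relative entropy of the prescribed marginal
with respect to the current one. This is at least the squared norm of the partial gradient divided
by γ, and the greedy block carries at least half of ‖∇φ‖². So every candidate ≥ γ is accepted
(`accepts_of_le`), whence L_{k+1} ≤ max(L_k/2, 2γ) and the weights A_k = L_k a_k² grow like k²/(8γ).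

The estimate-sequence argument (`State.Estimate.next`) maintains A_k(φ(η) + f(x̂)) + ‖ζ‖²/2 ≤ 0 with
ζ = −A_k γ e, e = 𝐀x̂ − b. Thus the gap φ(η) + f(x̂) is at most −A_k γ²‖e‖²/2, while a dual solution
y bounds it below by −γ‖y‖‖e‖. Comparing the two gives ‖e‖ ≤ 2‖y‖/(γA_k), and the other two rates
follow (`State.Estimate.bounds`). The size of y comes from bounding the oscillation of each block at
an optimum (`exists_dual_solution`).

For the complexity, the gap is nonpositive after every iteration, so only the rounding test matters.
The cost of rounding is controlled by the residual, and ρ ≤ 3‖C‖ for the perturbed marginals, so the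
test holds after O(√(N ln N) ‖C‖/ε) iterations. A rejection doubles the candidate and an acceptance
halves it, while candidates stay below 8γ; hence rejections exceed acceptances by less than a
constant depending on θ. Each pass costs O(N²). Correctness of the output (`isApproxPlan_of_tests`)
compares it with any competitor, itself rounded to the perturbed marginals. -/

noncomputable section

namespace AccSinkhorn

/-! ### Relative entropy on finite types -/

/-- The relative entropy `∑ p_i ln (p_i / q_i)`. -/
def relEntropy {ι : Type*} [Fintype ι] (p q : ι → ℝ) : ℝ :=
  ∑ i, p i * (Real.log (p i) - Real.log (q i))

theorem log_rational_bound_hasDerivAt {t : ℝ} (ht : 0 < t) :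
    HasDerivAt (fun t : ℝ => Real.log t - (t - 1) * (5 * t + 1) / (2 * t * (t + 2)))
      ((t - 1) ^ 3 / (t ^ 2 * (t + 2) ^ 2)) t := by
  have h0 : 2 * t * (t + 2) ≠ 0 := by positivity
  have h1 : HasDerivAt (fun t : ℝ => (t - 1) * (5 * t + 1))
      (1 * (5 * t + 1) + (t - 1) * (5 * 1)) t :=
    ((hasDerivAt_id t).sub_const 1).mul (((hasDerivAt_id t).const_mul 5).add_const 1)
  have h2 : HasDerivAt (fun t : ℝ => 2 * t * (t + 2)) (2 * 1 * (t + 2) + 2 * t * 1) t :=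
    ((hasDerivAt_id t).const_mul 2).mul ((hasDerivAt_id t).add_const 2)
  refine ((Real.hasDerivAt_log ht.ne').sub (h1.div h2 h0)).congr_deriv ?_
  field_simp
  ring

/-- The difference vanishes at t = 1, and its derivative (t − 1)³ / (t²(t + 2)²) changes sign only
there, so 1 is its global minimum. -/
theorem log_rational_bound {t : ℝ} (ht : 0 < t) :
    (t - 1) * (5 * t + 1) / (2 * t * (t + 2)) ≤ Real.log t := by
  have key : ∀ s : Set ℝ, Convex ℝ s → s ⊆ Set.Ioi 0 → ContinuousOn
      (fun t : ℝ => Real.log t - (t - 1) * (5 * t + 1) / (2 * t * (t + 2))) s :=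
    fun s _ hs x hx => (log_rational_bound_hasDerivAt (hs hx)).continuousAt.continuousWithinAt
  rcases le_total 1 t with h | h
  · have hm := monotoneOn_of_deriv_nonneg (convex_Ici (1 : ℝ))
      (key _ (convex_Ici 1) fun x (hx : 1 ≤ x) => by simp; linarith)
      (fun x hx => by
        rw [interior_Ici] at hx
        exact (log_rational_bound_hasDerivAt
          (by linarith [Set.mem_Ioi.1 hx])).differentiableAt.differentiableWithinAt)
      (fun x hx => by
        rw [interior_Ici] at hx
        have hx1 : 1 < x := hx
        rw [(log_rational_bound_hasDerivAt (by linarith)).deriv]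
        have : 0 ≤ (x - 1) ^ 3 := pow_nonneg (by linarith) 3
        positivity)
    have := hm (Set.mem_Ici.2 le_rfl) (Set.mem_Ici.2 h) h
    norm_num at this
    linarith
  · have hm := antitoneOn_of_deriv_nonpos (convex_Ioc (0 : ℝ) 1)
      (key _ (convex_Ioc 0 1) fun x hx => hx.1)
      (fun x hx => by
        rw [interior_Ioc] at hx
        exact (log_rational_bound_hasDerivAt hx.1).differentiableAt.differentiableWithinAt)
      (fun x hx => by
        rw [interior_Ioc] at hx
        rw [(log_rational_bound_hasDerivAt hx.1).deriv]
        have : (x - 1) ^ 3 ≤ 0 := by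
          have h1 : x - 1 ≤ 0 := by linarith [hx.2]
          nlinarith [sq_nonneg (x - 1)]
        have h3 : 0 ≤ x ^ 2 * (x + 2) ^ 2 := by positivity
        exact div_nonpos_of_nonpos_of_nonneg this h3)
    have := hm ⟨ht, h⟩ (⟨one_pos, le_rfl⟩ : (1 : ℝ) ∈ Set.Ioc (0 : ℝ) 1) h
    norm_num at this
    linarith

/-- At t = p/q the rational bound leaves exactly 3(p − q)² / (2(p + 2q)) below the last factor. The
weights (2p + 4q)/3 are useful because they sum to 2 over two probability vectors. -/
theorem sq_sub_le_entropy_term {p q : ℝ} (hp : 0 ≤ p) (hq : 0 < q) :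
    (p - q) ^ 2 ≤ ((2 * p + 4 * q) / 3) * (p * (Real.log p - Real.log q) - p + q) := by
  rcases hp.eq_or_lt with rfl | hp
  · simp; nlinarith
  have h := log_rational_bound (div_pos hp hq)
  rw [Real.log_div hp.ne' hq.ne'] at h
  have e : (p / q - 1) * (5 * (p / q) + 1) / (2 * (p / q) * (p / q + 2))
      = (p - q) * (5 * p + q) / (2 * p * (p + 2 * q)) := by
    field_simp
  rw [e, div_le_iff₀ (by positivity)] at h
  nlinarith

/-- Cauchy–Schwarz applied to the termwise bound: the weights have total 2 and the corrections −p +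
q cancel in the sum. -/
theorem pinsker {ι : Type*} [Fintype ι] {p q : ι → ℝ} (hp : ∀ i, 0 ≤ p i) (hq : ∀ i, 0 < q i)
    (hp1 : ∑ i, p i = 1) (hq1 : ∑ i, q i = 1) :
    (∑ i, |p i - q i|) ^ 2 / 2 ≤ relEntropy p q := by
  have h := Finset.sum_sq_le_sum_mul_sum_of_sq_le_mul Finset.univ
    (r := fun i => |p i - q i|) (f := fun i => (2 * p i + 4 * q i) / 3)
    (g := fun i => p i * (Real.log (p i) - Real.log (q i)) - p i + q i)
    (fun i _ => by have := hp i; have := hq i; positivity)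
    (fun i _ => by
      have h := (sq_nonneg _).trans (sq_sub_le_entropy_term (hp i) (hq i))
      have h2 : 0 < (2 * p i + 4 * q i) / 3 := by have := hp i; have := hq i; positivity
      exact nonneg_of_mul_nonneg_right h h2)
    (fun i _ => by rw [sq_abs]; exact sq_sub_le_entropy_term (hp i) (hq i))
  have e1 : ∑ i, (2 * p i + 4 * q i) / 3 = 2 := by
    rw [← Finset.sum_div, Finset.sum_add_distrib, ← Finset.mul_sum, ← Finset.mul_sum, hp1, hq1]
    norm_num
  have e2 : ∑ i, (p i * (Real.log (p i) - Real.log (q i)) - p i + q i) = relEntropy p q := by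
    rw [Finset.sum_add_distrib, Finset.sum_sub_distrib, hp1, hq1, relEntropy]; ring
  rw [e1, e2] at h
  linarith

/-- Each entry is minus the sum of the others, so twice its absolute value is at most the 1-norm. -/
theorem two_mul_sum_sq_le_of_sum_eq_zero {ι : Type*} [Fintype ι] {x : ι → ℝ}
    (hx : ∑ i, x i = 0) : 2 * ∑ i, x i ^ 2 ≤ (∑ i, |x i|) ^ 2 := by
  classical
  have h : ∀ i, 2 * |x i| ≤ ∑ j, |x j| := fun i => by
    have h1 := Finset.add_sum_erase Finset.univ x (Finset.mem_univ i)
    have h2 := Finset.add_sum_erase Finset.univ (fun j => |x j|) (Finset.mem_univ i)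
    have h3 := Finset.abs_sum_le_sum_abs x (Finset.univ.erase i)
    have h4 : x i = -∑ j ∈ Finset.univ.erase i, x j := by linarith
    have h5 : |x i| = |∑ j ∈ Finset.univ.erase i, x j| := by rw [h4, abs_neg]
    linarith
  rw [Finset.mul_sum, sq, Finset.sum_mul]
  refine Finset.sum_le_sum fun i _ => ?_
  have := mul_le_mul_of_nonneg_left (h i) (abs_nonneg (x i))
  nlinarith [sq_abs (x i)]

/-- The constant 1, instead of the 1/2 that Pinsker gives with ‖·‖₂ ≤ ‖·‖₁, is what makes γ rather
than 2γ the acceptance threshold. -/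
theorem sum_sq_sub_le_relEntropy {ι : Type*} [Fintype ι] {p q : ι → ℝ} (hp : ∀ i, 0 ≤ p i)
    (hq : ∀ i, 0 < q i) (hp1 : ∑ i, p i = 1) (hq1 : ∑ i, q i = 1) :
    ∑ i, (p i - q i) ^ 2 ≤ relEntropy p q := by
  have h1 := pinsker hp hq hp1 hq1
  have h2 := two_mul_sum_sq_le_of_sum_eq_zero (x := fun i => p i - q i)
    (by rw [Finset.sum_sub_distrib, hp1, hq1, sub_self])
  linarith

/-! ### The dual space -/

section DualSpace

variable {N : ℕ}

@[simp] theorem mkDual_inl (u v : Fin N → ℝ) (i : Fin N) : mkDual u v (Sum.inl i) = u i := rfl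

@[simp] theorem mkDual_inr (u v : Fin N → ℝ) (j : Fin N) : mkDual u v (Sum.inr j) = v j := rfl

@[simp] theorem marginals_inl (X : Matrix (Fin N) (Fin N) ℝ) (i : Fin N) :
    marginals X (Sum.inl i) = ∑ j, X i j := by
  simp [marginals, Matrix.mulVec, dotProduct]

@[simp] theorem marginals_inr (X : Matrix (Fin N) (Fin N) ℝ) (j : Fin N) :
    marginals X (Sum.inr j) = ∑ i, X i j := by
  simp [marginals, Matrix.mulVec, dotProduct]

theorem marginals_add (X Y : Matrix (Fin N) (Fin N) ℝ) :
    marginals (X + Y) = marginals X + marginals Y := by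
  ext (i | j) <;> simp [Finset.sum_add_distrib]

theorem marginals_smul (a : ℝ) (X : Matrix (Fin N) (Fin N) ℝ) :
    marginals (a • X) = a • marginals X := by
  ext (i | j) <;> simp [Finset.mul_sum]

theorem marginals_eq_mkDual_iff {X : Matrix (Fin N) (Fin N) ℝ} {r c : Fin N → ℝ} :
    marginals X = mkDual r c ↔ X *ᵥ 1 = r ∧ Xᵀ *ᵥ 1 = c := by
  constructor
  · intro h
    exact ⟨funext fun i => congrArg (fun p : Dual N => p (Sum.inl i)) h,
      funext fun j => congrArg (fun p : Dual N => p (Sum.inr j)) h⟩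
  · rintro ⟨rfl, rfl⟩; rfl

theorem inner_dual (x y : Dual N) :
    inner ℝ x y = ∑ i, x (Sum.inl i) * y (Sum.inl i) + ∑ j, x (Sum.inr j) * y (Sum.inr j) := by
  simp [PiLp.inner_apply, Fintype.sum_sum_type, mul_comm]

theorem normSq_dual (x : Dual N) : ‖x‖ ^ 2 = blockSq x .u + blockSq x .v := by
  rw [← real_inner_self_eq_norm_sq, inner_dual]
  simp [blockSq, sq]

theorem inner_marginals (y : Dual N) (X : Matrix (Fin N) (Fin N) ℝ) :
    inner ℝ y (marginals X) = ∑ i, ∑ j, X i j * (y (Sum.inl i) + y (Sum.inr j)) := by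
  rw [inner_dual]
  simp only [marginals_inl, marginals_inr, Finset.mul_sum]
  rw [Finset.sum_comm (f := fun j i => y (Sum.inr j) * X i j), ← Finset.sum_add_distrib]
  refine Finset.sum_congr rfl fun i _ => ?_
  rw [← Finset.sum_add_distrib]
  exact Finset.sum_congr rfl fun j _ => by ring

/-- A joint distribution: a nonnegative matrix of total mass one. -/
def IsJoint (X : Matrix (Fin N) (Fin N) ℝ) : Prop := (∀ i j, 0 ≤ X i j) ∧ ∑ i, ∑ j, X i j = 1

theorem isJoint_of_mem {X : Matrix (Fin N) (Fin N) ℝ} {r c : Fin N → ℝ} (hr : IsHistogram r)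
    (hX : X ∈ transportPolytope r c) : IsJoint X := by
  refine ⟨hX.1, ?_⟩
  rw [← hr.2, ← hX.2.1]
  simp [Matrix.mulVec, dotProduct]

theorem marginals_of_mem {X : Matrix (Fin N) (Fin N) ℝ} {r c : Fin N → ℝ}
    (hX : X ∈ transportPolytope r c) : marginals X = mkDual r c :=
  marginals_eq_mkDual_iff.2 hX.2

/-! ### The dual objective -/

variable (C : Matrix (Fin N) (Fin N) ℝ) (r c : Fin N → ℝ) (γ : ℝ)

theorem kernelB_apply (p : Dual N) (i j : Fin N) :
    kernelB C γ p i j = Real.exp (p (Sum.inl i) + p (Sum.inr j) - C i j / γ) := rfl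

theorem kernelB_pos (p : Dual N) (i j : Fin N) : 0 < kernelB C γ p i j := Real.exp_pos _

theorem mass_pos [NeZero N] (p : Dual N) : 0 < mass C γ p :=
  Finset.sum_pos (fun i _ => Finset.sum_pos (fun j _ => kernelB_pos C γ p i j)
    Finset.univ_nonempty) Finset.univ_nonempty

theorem primalPoint_apply (p : Dual N) (i j : Fin N) :
    primalPoint C γ p i j = (mass C γ p)⁻¹ * kernelB C γ p i j := rfl

theorem primalPoint_pos [NeZero N] (p : Dual N) (i j : Fin N) : 0 < primalPoint C γ p i j :=
  mul_pos (inv_pos.2 (mass_pos C γ p)) (kernelB_pos C γ p i j)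

theorem isJoint_primalPoint [NeZero N] (p : Dual N) : IsJoint (primalPoint C γ p) := by
  refine ⟨fun i j => (primalPoint_pos C γ p i j).le, ?_⟩
  simp only [primalPoint_apply, ← Finset.mul_sum]
  exact inv_mul_cancel₀ (mass_pos C γ p).ne'

theorem log_primalPoint [NeZero N] (p : Dual N) (i j : Fin N) :
    Real.log (primalPoint C γ p i j)
      = p (Sum.inl i) + p (Sum.inr j) - C i j / γ - Real.log (mass C γ p) := by
  rw [primalPoint_apply, Real.log_mul (inv_pos.2 (mass_pos C γ p)).ne' (kernelB_pos C γ p i j).ne',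
    Real.log_inv, kernelB_apply, Real.log_exp]
  ring

/-- The gradient of the dual objective in closed form. -/
def dualGrad (p : Dual N) : Dual N := γ • (marginals (primalPoint C γ p) - mkDual r c)

theorem dualObj_eq (p : Dual N) :
    dualObj C r c γ p = γ * (Real.log (mass C γ p) - inner ℝ p (mkDual r c)) := by
  rw [dualObj, inner_dual]
  simp only [mkDual_inl, mkDual_inr]
  ring

theorem hasGradientAt_dualObj [NeZero N] (p : Dual N) :
    HasGradientAt (dualObj C r c γ) (dualGrad C r c γ p) p := by
  rw [hasGradientAt_iff_hasFDerivAt]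
  have hproj : ∀ s : Fin N ⊕ Fin N, HasFDerivAt (fun p : Dual N => p s)
      (EuclideanSpace.proj s : Dual N →L[ℝ] ℝ) p := fun s =>
    (EuclideanSpace.proj s : Dual N →L[ℝ] ℝ).hasFDerivAt
  have hker : ∀ i j, HasFDerivAt (fun p : Dual N => kernelB C γ p i j)
      (kernelB C γ p i j • ((EuclideanSpace.proj (Sum.inl i) : Dual N →L[ℝ] ℝ)
        + EuclideanSpace.proj (Sum.inr j))) p := fun i j =>
    (((hproj (Sum.inl i)).add (hproj (Sum.inr j))).sub_const (C i j / γ)).exp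
  have hmass : HasFDerivAt (fun p : Dual N => mass C γ p)
      (∑ i, ∑ j, kernelB C γ p i j • ((EuclideanSpace.proj (Sum.inl i) : Dual N →L[ℝ] ℝ)
        + EuclideanSpace.proj (Sum.inr j))) p :=
    HasFDerivAt.fun_sum fun i _ => HasFDerivAt.fun_sum fun j _ => hker i j
  have hinner : HasFDerivAt (fun p : Dual N => inner ℝ p (mkDual r c))
      (innerSL ℝ (mkDual r c)) p := by
    have := (innerSL ℝ (mkDual r c)).hasFDerivAt (x := p)
    refine this.congr_of_eventuallyEq (Filter.Eventually.of_forall fun q => ?_)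
    simp [real_inner_comm]
  have h := ((hmass.log (mass_pos C γ p).ne').sub hinner).const_mul γ
  have e : dualObj C r c γ = fun p => γ * (Real.log (mass C γ p) - inner ℝ p (mkDual r c)) :=
    funext fun p => dualObj_eq C r c γ p
  rw [e]
  refine h.congr_fderiv ?_
  ext y
  have e2 : inner ℝ (dualGrad C r c γ p) y = γ * ((mass C γ p)⁻¹ *
      (∑ i, ∑ j, kernelB C γ p i j * (y (Sum.inl i) + y (Sum.inr j))) - inner ℝ (mkDual r c) y) := by
    rw [dualGrad, inner_smul_left, inner_sub_left, real_inner_comm, inner_marginals]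
    simp [primalPoint_apply, Finset.mul_sum, mul_assoc]
  simp only [InnerProductSpace.toDual_apply_apply, e2]
  simp [mul_add]

theorem gradient_dualObj [NeZero N] (p : Dual N) :
    gradient (dualObj C r c γ) p = dualGrad C r c γ p :=
  (hasGradientAt_dualObj C r c γ p).gradient

theorem regObj_eq (X : Matrix (Fin N) (Fin N) ℝ) :
    regObj C γ X = ∑ i, ∑ j, X i j * (C i j + γ * Real.log (X i j)) := by
  simp only [regObj, frob, Matrix.map_apply, Finset.mul_sum, ← Finset.sum_add_distrib]
  exact Finset.sum_congr rfl fun i _ => Finset.sum_congr rfl fun j _ => by ring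

/-- The relative entropy of two matrices. -/
def matEntropy (X Y : Matrix (Fin N) (Fin N) ℝ) : ℝ :=
  relEntropy (fun p : Fin N × Fin N => X p.1 p.2) fun p => Y p.1 p.2

theorem pinsker_matrix {X Y : Matrix (Fin N) (Fin N) ℝ} (hX : IsJoint X) (hY : IsJoint Y)
    (hpos : ∀ i j, 0 < Y i j) : l1Norm (X - Y) ^ 2 / 2 ≤ matEntropy X Y := by
  have := pinsker (p := fun p : Fin N × Fin N => X p.1 p.2) (q := fun p => Y p.1 p.2)
    (fun p => hX.1 _ _) (fun p => hpos _ _) (by rw [Fintype.sum_prod_type]; exact hX.2)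
    (by rw [Fintype.sum_prod_type]; exact hY.2)
  rwa [Fintype.sum_prod_type] at this

variable {γ}

/-- The duality gap is a relative entropy, up to the violation of the constraints. -/
theorem regObj_add_dualObj [NeZero N] (hγ : 0 < γ) {X : Matrix (Fin N) (Fin N) ℝ}
    (hX : IsJoint X) (y : Dual N) :
    regObj C γ X + dualObj C r c γ y - γ * inner ℝ y (marginals X - mkDual r c)
      = γ * matEntropy X (primalPoint C γ y) := by
  have e : matEntropy X (primalPoint C γ y) = ∑ i, ∑ j, X i j * (Real.log (X i j)
      - (y (Sum.inl i) + y (Sum.inr j) - C i j / γ - Real.log (mass C γ y))) := by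
    rw [matEntropy, relEntropy, Fintype.sum_prod_type]
    simp only [log_primalPoint]
  have e3 : Real.log (mass C γ y) = ∑ i, ∑ j, X i j * Real.log (mass C γ y) := by
    simp only [← Finset.sum_mul, hX.2, one_mul]
  rw [dualObj_eq, inner_sub_right, inner_marginals, e, regObj_eq]
  -- The term γ⟨y, b⟩ occurs both in φ and in the constraint correction, and cancels.
  have e4 : ∀ A B D I : ℝ, A + γ * (B - I) - γ * (D - I) = A + γ * B - γ * D := by
    intros; ring
  rw [e4, e3]
  simp only [Finset.mul_sum, ← Finset.sum_add_distrib, ← Finset.sum_sub_distrib]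
  refine Finset.sum_congr rfl fun i _ => Finset.sum_congr rfl fun j _ => ?_
  rw [← e3]
  field_simp
  ring

theorem matEntropy_nonneg [NeZero N] {X : Matrix (Fin N) (Fin N) ℝ} (hX : IsJoint X)
    (y : Dual N) : 0 ≤ matEntropy X (primalPoint C γ y) :=
  le_trans (by positivity) (pinsker_matrix hX (isJoint_primalPoint C γ y) (primalPoint_pos C γ y))

theorem weak_duality [NeZero N] (hγ : 0 < γ) {X : Matrix (Fin N) (Fin N) ℝ}
    (hX : IsJoint X) (y : Dual N) :
    γ * inner ℝ y (marginals X - mkDual r c) - dualObj C r c γ y ≤ regObj C γ X := by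
  have h1 := regObj_add_dualObj C r c hγ hX y
  have h2 := mul_nonneg hγ.le (matEntropy_nonneg C (γ := γ) hX y)
  linarith

theorem regObj_primalPoint [NeZero N] (hγ : 0 < γ) (y : Dual N) :
    regObj C γ (primalPoint C γ y) = inner ℝ y (dualGrad C r c γ y) - dualObj C r c γ y := by
  have h1 := regObj_add_dualObj C r c hγ (isJoint_primalPoint C γ y) y
  have h2 : matEntropy (primalPoint C γ y) (primalPoint C γ y) = 0 := by
    simp [matEntropy, relEntropy]
  rw [h2, mul_zero] at h1
  rw [dualGrad, inner_smul_right]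
  linarith

/-- Convexity of φ without second derivatives: weak duality for the pair x(p), y becomes this once
f(x(p)) is evaluated by the equality case of the gap identity. -/
theorem dualObj_tangent_le [NeZero N] (hγ : 0 < γ) (p y : Dual N) :
    dualObj C r c γ p + inner ℝ (y - p) (dualGrad C r c γ p) ≤ dualObj C r c γ y := by
  have h1 := weak_duality C r c hγ (isJoint_primalPoint C γ p) y
  have h2 := regObj_primalPoint C r c hγ p
  have h3 : inner ℝ y (dualGrad C r c γ p)
      = γ * inner ℝ y (marginals (primalPoint C γ p) - mkDual r c) := by
    rw [dualGrad, inner_smul_right]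
  rw [inner_sub_left]
  linarith

/-- On the polytope the constraint term vanishes, so f equals γ KL(· ‖ x(y)) − φ(y), which by
Pinsker is minimal only at x(y). -/
theorem isRegSolution_primalPoint_iff [NeZero N] (hγ : 0 < γ) (hr : IsHistogram r) {y : Dual N}
    (hy : marginals (primalPoint C γ y) = mkDual r c) (Y : Matrix (Fin N) (Fin N) ℝ) :
    IsRegSolution C r c γ Y ↔ Y = primalPoint C γ y := by
  have hmem : primalPoint C γ y ∈ transportPolytope r c :=
    ⟨(isJoint_primalPoint C γ y).1, marginals_eq_mkDual_iff.1 hy⟩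
  have hval : ∀ X ∈ transportPolytope r c, regObj C γ X
      = γ * matEntropy X (primalPoint C γ y) - dualObj C r c γ y := fun X hX => by
    have := regObj_add_dualObj C r c hγ (isJoint_of_mem hr hX) y
    rw [marginals_of_mem hX, sub_self, inner_zero_right] at this
    linarith
  have hself : matEntropy (primalPoint C γ y) (primalPoint C γ y) = 0 := by
    simp [matEntropy, relEntropy]
  constructor
  · rintro ⟨hY, hmin⟩
    have h1 : regObj C γ Y ≤ regObj C γ (primalPoint C γ y) := hmin hmem
    rw [hval Y hY, hval _ hmem, hself] at h1
    have h2 := pinsker_matrix (isJoint_of_mem hr hY) (isJoint_primalPoint C γ y)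
      (primalPoint_pos C γ y)
    have h3 : matEntropy Y (primalPoint C γ y) ≤ 0 := by
      by_contra! h
      have := mul_pos hγ h
      linarith
    have h4 : l1Norm (Y - primalPoint C γ y) = 0 := by nlinarith
    ext i j
    have h5 := (Finset.sum_eq_zero_iff_of_nonneg fun i _ =>
      Finset.sum_nonneg fun j _ => abs_nonneg ((Y - primalPoint C γ y) i j)).1 h4 i
        (Finset.mem_univ i)
    have h6 := (Finset.sum_eq_zero_iff_of_nonneg fun j _ =>
      abs_nonneg ((Y - primalPoint C γ y) i j)).1 h5 j (Finset.mem_univ j)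
    simpa [sub_eq_zero] using h6
  · rintro rfl
    refine ⟨hmem, fun X hX => ?_⟩
    change regObj C γ _ ≤ regObj C γ X
    rw [hval X hX, hval _ hmem, hself]
    have := mul_nonneg hγ.le (matEntropy_nonneg C (γ := γ) (isJoint_of_mem hr hX) y)
    linarith

end DualSpace

/-! ### Decrease of the dual objective along a Sinkhorn update -/

section Sinkhorn

variable {N : ℕ} (C : Matrix (Fin N) (Fin N) ℝ) {r c : Fin N → ℝ} {γ : ℝ}

theorem dualGrad_inl (p : Dual N) (i : Fin N) : dualGrad C r c γ p (Sum.inl i)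
    = γ * ((kernelB C γ p *ᵥ 1) i / mass C γ p - r i) := by
  simp [dualGrad, primalPoint_apply, ← Finset.mul_sum, Matrix.mulVec, dotProduct, div_eq_inv_mul]

theorem dualGrad_inr (p : Dual N) (j : Fin N) : dualGrad C r c γ p (Sum.inr j)
    = γ * (((kernelB C γ p)ᵀ *ᵥ 1) j / mass C γ p - c j) := by
  simp [dualGrad, primalPoint_apply, ← Finset.mul_sum, Matrix.mulVec, dotProduct, div_eq_inv_mul]

theorem mass_eq_rowSums (p : Dual N) : mass C γ p = ∑ i, (kernelB C γ p *ᵥ 1) i := by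
  simp [mass, Matrix.mulVec, dotProduct]

theorem mass_eq_colSums (p : Dual N) : mass C γ p = ∑ j, ((kernelB C γ p)ᵀ *ᵥ 1) j := by
  have e : mass C γ p = ∑ j, ∑ i, kernelB C γ p i j := Finset.sum_comm
  rw [e]
  simp [Matrix.mulVec, dotProduct]

theorem exists_isGreedyBlock (p : Dual N) : ∃ b, IsGreedyBlock C r c γ p b := by
  rcases le_total (blockSq (gradient (dualObj C r c γ) p) .u)
    (blockSq (gradient (dualObj C r c γ) p) .v) with h | h
  · exact ⟨.v, fun b' => by cases b' <;> [exact h; exact le_rfl]⟩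
  · exact ⟨.u, fun b' => by cases b' <;> [exact le_rfl; exact h]⟩

variable [NeZero N]

theorem kernelB_rowSum_pos (p : Dual N) (i : Fin N) : 0 < (kernelB C γ p *ᵥ 1) i := by
  simpa [Matrix.mulVec, dotProduct] using
    Finset.sum_pos (fun j _ => kernelB_pos C γ p i j) Finset.univ_nonempty

theorem kernelB_colSum_pos (p : Dual N) (j : Fin N) : 0 < ((kernelB C γ p)ᵀ *ᵥ 1) j := by
  simpa [Matrix.mulVec, dotProduct] using
    Finset.sum_pos (fun i _ => kernelB_pos C γ p i j) Finset.univ_nonempty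

/-- The update rescales row i of the kernel to have sum r_i. The logarithm in φ therefore vanishes
after an update. -/
theorem mass_blockUpdate_u (hr : IsHistogram r) (hr0 : ∀ i, 0 < r i) (p : Dual N) :
    mass C γ (blockUpdate C r c γ p .u) = 1 := by
  rw [← hr.2, mass]
  refine Finset.sum_congr rfl fun i _ => ?_
  have h := kernelB_rowSum_pos C (γ := γ) p i
  have e : ∀ j, kernelB C γ (blockUpdate C r c γ p .u) i j
      = r i / (kernelB C γ p *ᵥ 1) i * kernelB C γ p i j := fun j => by
    rw [kernelB_apply, kernelB_apply, ← Real.exp_log (div_pos (hr0 i) h),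
      Real.log_div (hr0 i).ne' h.ne', ← Real.exp_add]
    simp only [blockUpdate, mkDual_inl, mkDual_inr]
    congr 1
    ring
  simp only [e, ← Finset.mul_sum]
  have e2 : ∑ j, kernelB C γ p i j = (kernelB C γ p *ᵥ 1) i := by
    simp [Matrix.mulVec, dotProduct]
  rw [e2, div_mul_cancel₀ _ h.ne']

theorem mass_blockUpdate_v (hc : IsHistogram c) (hc0 : ∀ j, 0 < c j) (p : Dual N) :
    mass C γ (blockUpdate C r c γ p .v) = 1 := by
  have e0 : mass C γ (blockUpdate C r c γ p .v)
      = ∑ j, ∑ i, kernelB C γ (blockUpdate C r c γ p .v) i j := Finset.sum_comm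
  rw [← hc.2, e0]
  refine Finset.sum_congr rfl fun j _ => ?_
  have h := kernelB_colSum_pos C (γ := γ) p j
  have e : ∀ i, kernelB C γ (blockUpdate C r c γ p .v) i j
      = c j / ((kernelB C γ p)ᵀ *ᵥ 1) j * kernelB C γ p i j := fun i => by
    rw [kernelB_apply, kernelB_apply, ← Real.exp_log (div_pos (hc0 j) h),
      Real.log_div (hc0 j).ne' h.ne', ← Real.exp_add]
    simp only [blockUpdate, mkDual_inl, mkDual_inr]
    congr 1
    ring
  simp only [e, ← Finset.mul_sum]
  have e2 : ∑ i, kernelB C γ p i j = ((kernelB C γ p)ᵀ *ᵥ 1) j := by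
    simp [Matrix.mulVec, dotProduct]
  rw [e2, div_mul_cancel₀ _ h.ne']

/-- The decrease obtained by normalizing a positive weight `w` of total mass `S`. -/
theorem sum_sq_le_log_decrease {w s : Fin N → ℝ} (hs : IsHistogram s)
    (hw : ∀ i, 0 < w i) {S : ℝ} (hS : S = ∑ i, w i) :
    ∑ i, (w i / S - s i) ^ 2 ≤ Real.log S + ∑ i, s i * (Real.log (s i) - Real.log (w i)) := by
  have hS0 : 0 < S := hS ▸ Finset.sum_pos (fun i _ => hw i) Finset.univ_nonempty
  have h := sum_sq_sub_le_relEntropy (p := s) (q := fun i => w i / S) hs.1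
    (fun i => div_pos (hw i) hS0) hs.2 (by rw [← Finset.sum_div, ← hS, div_self hS0.ne'])
  have e : relEntropy s (fun i => w i / S)
      = Real.log S + ∑ i, s i * (Real.log (s i) - Real.log (w i)) := by
    have : Real.log S = ∑ i, s i * Real.log S := by rw [← Finset.sum_mul, hs.2, one_mul]
    rw [relEntropy, this, ← Finset.sum_add_distrib]
    refine Finset.sum_congr rfl fun i _ => ?_
    rw [Real.log_div (hw i).ne' hS0.ne']
    ring
  rw [← e]
  refine le_trans (le_of_eq ?_) h
  exact Finset.sum_congr rfl fun i _ => by ring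

/-- The decrease is γ times the relative entropy of the prescribed marginal with respect to the
current one, which dominates the squared Euclidean distance. The partial gradient is γ times the
difference of these marginals, which explains the division by γ. -/
theorem dualObj_blockUpdate_le (hγ : 0 < γ) (hr : IsHistogram r) (hc : IsHistogram c)
    (hr0 : ∀ i, 0 < r i) (hc0 : ∀ j, 0 < c j) (p : Dual N) (b : Block) :
    dualObj C r c γ (blockUpdate C r c γ p b)
      ≤ dualObj C r c γ p - blockSq (dualGrad C r c γ p) b / γ := by
  cases b with
  | u =>
    have h := sum_sq_le_log_decrease hr (kernelB_rowSum_pos C (γ := γ) p) (mass_eq_rowSums C p)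
    have e1 : blockSq (dualGrad C r c γ p) .u / γ
        = γ * ∑ i, ((kernelB C γ p *ᵥ 1) i / mass C γ p - r i) ^ 2 := by
      simp only [blockSq, dualGrad_inl, mul_pow, ← Finset.mul_sum]
      field_simp
    rw [e1, dualObj, dualObj, mass_blockUpdate_u C hr hr0, Real.log_one]
    have e2 : ∑ i, (blockUpdate C r c γ p .u) (Sum.inl i) * r i = ∑ i, p (Sum.inl i) * r i
        + ∑ i, r i * (Real.log (r i) - Real.log ((kernelB C γ p *ᵥ 1) i)) := by
      rw [← Finset.sum_add_distrib]
      refine Finset.sum_congr rfl fun i _ => ?_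
      simp only [blockUpdate, mkDual_inl]
      ring
    have e3 : ∑ j, (blockUpdate C r c γ p .u) (Sum.inr j) * c j = ∑ j, p (Sum.inr j) * c j := rfl
    rw [e2, e3]
    have := mul_le_mul_of_nonneg_left h hγ.le
    nlinarith
  | v =>
    have h := sum_sq_le_log_decrease hc (kernelB_colSum_pos C (γ := γ) p) (mass_eq_colSums C p)
    have e1 : blockSq (dualGrad C r c γ p) .v / γ
        = γ * ∑ j, (((kernelB C γ p)ᵀ *ᵥ 1) j / mass C γ p - c j) ^ 2 := by
      simp only [blockSq, dualGrad_inr, mul_pow, ← Finset.mul_sum]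
      field_simp
    rw [e1, dualObj, dualObj, mass_blockUpdate_v C hc hc0, Real.log_one]
    have e2 : ∑ j, (blockUpdate C r c γ p .v) (Sum.inr j) * c j = ∑ j, p (Sum.inr j) * c j
        + ∑ j, c j * (Real.log (c j) - Real.log (((kernelB C γ p)ᵀ *ᵥ 1) j)) := by
      rw [← Finset.sum_add_distrib]
      refine Finset.sum_congr rfl fun j _ => ?_
      simp only [blockUpdate, mkDual_inr]
      ring
    have e3 : ∑ i, (blockUpdate C r c γ p .v) (Sum.inl i) * r i = ∑ i, p (Sum.inl i) * r i := rfl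
    rw [e2, e3]
    have := mul_le_mul_of_nonneg_left h hγ.le
    nlinarith

/-- The greedy block carries at least half of ‖∇φ‖², and the update gains its squared norm divided
by γ, that is at least ‖∇φ‖²/(2γ). This makes the line search terminate and bounds the accepted L by
2γ after any rejection. -/
theorem accepts_of_le (hγ : 0 < γ) (hr : IsHistogram r) (hc : IsHistogram c)
    (hr0 : ∀ i, 0 < r i) (hc0 : ∀ j, 0 < c j) (s : State N) {L' : ℝ} (hL : γ ≤ L') {b : Block}
    (hb : IsGreedyBlock C r c γ (s.lam L') b) : s.Accepts C r c γ L' b := by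
  have h := dualObj_blockUpdate_le C hγ hr hc hr0 hc0 (s.lam L') b
  have hu := hb .u
  have hv := hb .v
  rw [gradient_dualObj] at hu hv
  have h2 := normSq_dual (dualGrad C r c γ (s.lam L'))
  rw [State.Accepts, gradient_dualObj]
  change dualObj C r c γ (blockUpdate C r c γ (s.lam L') b) ≤ _
  have h3 : ‖dualGrad C r c γ (s.lam L')‖ ^ 2 / (2 * L')
      ≤ blockSq (dualGrad C r c γ (s.lam L')) b / γ := by
    rw [div_le_div_iff₀ (by linarith) hγ]
    have h4 : ‖dualGrad C r c γ (s.lam L')‖ ^ 2 ≤ 2 * blockSq (dualGrad C r c γ (s.lam L')) b := by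
      linarith
    have h5 : 0 ≤ ‖dualGrad C r c γ (s.lam L')‖ ^ 2 := by positivity
    nlinarith
  linarith

theorem exists_isIteration (hγ : 0 < γ) (hr : IsHistogram r) (hc : IsHistogram c)
    (hr0 : ∀ i, 0 < r i) (hc0 : ∀ j, 0 < c j) (s : State N) (hL : 0 < s.L) :
    ∃ s', IsIteration C r c γ s s' ∧ 0 < s'.L := by
  classical
  -- The blocks are fixed for all candidates in advance, so that the first accepted one is well
  -- defined.
  choose b hb using fun m : ℕ => exists_isGreedyBlock C (r := r) (c := c) (γ := γ)
    (s.lam (2 ^ m * (s.L / 2)))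
  have hex : ∃ n, s.Accepts C r c γ (2 ^ n * (s.L / 2)) (b n) := by
    obtain ⟨n, hn⟩ := pow_unbounded_of_one_lt (γ / (s.L / 2)) (one_lt_two (α := ℝ))
    refine ⟨n, accepts_of_le C hγ hr hc hr0 hc0 s ?_ (hb n)⟩
    rw [div_lt_iff₀ (by positivity)] at hn
    exact hn.le
  refine ⟨_, ⟨Nat.find hex, b, fun m _ => hb m, fun m hm => Nat.find_min hex hm,
    Nat.find_spec hex, rfl⟩, ?_⟩
  change 0 < 2 ^ _ * (s.L / 2)
  positivity

theorem exists_isRun (hγ : 0 < γ) (hr : IsHistogram r) (hc : IsHistogram c)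
    (hr0 : ∀ i, 0 < r i) (hc0 : ∀ j, 0 < c j) {L₀ : ℝ} (hL : 0 < L₀) :
    ∃ s, IsRun C r c γ L₀ s := by
  choose f hf using fun s : {s : State N // 0 < s.L} =>
    exists_isIteration C hγ hr hc hr0 hc0 s.1 s.2
  let t : ℕ → {s : State N // 0 < s.L} := fun k =>
    Nat.rec ⟨State.init N L₀, hL⟩ (fun _ s => ⟨f s, (hf s).2⟩) k
  exact ⟨fun k => (t k).1, rfl, fun k => (hf (t k)).1⟩

end Sinkhorn

/-! ### The invariants of Accelerated Sinkhorn -/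

section Invariant

variable {N : ℕ} (C : Matrix (Fin N) (Fin N) ℝ) (r c : Fin N → ℝ) (γ : ℝ)

/-- The weight `A_k = L_k a_k²`. -/
def State.A (s : State N) : ℝ := s.L * s.a ^ 2

/-- The estimate-sequence inequality in closed form, together with the description of `ζ` as a
multiple of the residual of the averaged primal point. -/
structure State.Estimate (s : State N) : Prop where
  L_pos : 0 < s.L
  a_nonneg : 0 ≤ s.a
  zeta_eq : s.ζ = -(s.A * γ) • (marginals s.xhat - mkDual r c)
  gap_le : s.A * (dualObj C r c γ s.η + regObj C γ s.xhat) + ‖s.ζ‖ ^ 2 / 2 ≤ 0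
  xhat_nonneg : ∀ i j, 0 ≤ s.xhat i j
  xhat_sum : 0 < s.A → ∑ i, ∑ j, s.xhat i j = 1

theorem State.estimate_init {L₀ : ℝ} (hL : 0 < L₀) :
    (State.init N L₀).Estimate C r c γ where
  L_pos := hL
  a_nonneg := le_rfl
  zeta_eq := by simp [State.init, State.A]
  gap_le := by simp [State.init, State.A]
  xhat_nonneg := fun _ _ => le_rfl
  xhat_sum := fun h => by simp [State.init, State.A] at h

variable {C r c γ}

theorem State.nextA_pos (s : State N) {L' : ℝ} (hL' : 0 < L') : 0 < s.nextA L' := by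
  have := Real.sqrt_nonneg (1 / (4 * L' ^ 2) + s.a ^ 2 * (s.L / L'))
  have h : 0 < 1 / (2 * L') := by positivity
  rw [State.nextA]
  linarith

/-- The step size is the positive root of L'a² − a = A; hence the weights simply add up, A_{k+1} =
A_k + a_{k+1}. -/
theorem State.nextA_sq (s : State N) (hL : 0 < s.L) {L' : ℝ} (hL' : 0 < L') :
    L' * s.nextA L' ^ 2 = s.A + s.nextA L' := by
  have h : 0 ≤ 1 / (4 * L' ^ 2) + s.a ^ 2 * (s.L / L') := by positivity
  have h2 := Real.sq_sqrt h
  rw [State.nextA, State.A]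
  set w := √(1 / (4 * L' ^ 2) + s.a ^ 2 * (s.L / L'))
  have e : L' * (1 / (2 * L') + w) ^ 2 = 1 / (4 * L') + w + L' * w ^ 2 := by
    field_simp
    ring
  rw [e, h2]
  field_simp
  ring

theorem regObj_convex (hγ : 0 < γ) {X Y : Matrix (Fin N) (Fin N) ℝ} (hX : ∀ i j, 0 ≤ X i j)
    (hY : ∀ i j, 0 ≤ Y i j) {α β : ℝ} (hα : 0 ≤ α) (hβ : 0 ≤ β) (h : α + β = 1) :
    regObj C γ (α • X + β • Y) ≤ α * regObj C γ X + β * regObj C γ Y := by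
  simp only [regObj_eq, Finset.mul_sum, ← Finset.sum_add_distrib]
  refine Finset.sum_le_sum fun i _ => Finset.sum_le_sum fun j _ => ?_
  have h1 := Real.convexOn_mul_log.2 (hX i j) (hY i j) hα hβ h
  simp only [smul_eq_mul] at h1
  simp only [Matrix.add_apply, Matrix.smul_apply, smul_eq_mul]
  have h2 := mul_le_mul_of_nonneg_left h1 hγ.le
  nlinarith

theorem State.A_nonneg {s : State N} (hs : s.Estimate C r c γ) : 0 ≤ s.A :=
  mul_nonneg hs.L_pos.le (sq_nonneg _)

theorem State.A_next (s : State N) (hL : 0 < s.L) {L' : ℝ} (hL' : 0 < L') (b : Block) :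
    (s.next C r c γ L' b).A = s.A + s.nextA L' := s.nextA_sq hL hL'

theorem State.xhat_next (s : State N) (hL : 0 < s.L) {L' : ℝ} (hL' : 0 < L') (b : Block) :
    (s.next C r c γ L' b).xhat = (s.nextA L' / (s.A + s.nextA L')) • primalPoint C γ (s.lam L')
      + (s.A / (s.A + s.nextA L')) • s.xhat := by
  change (1 / (L' * s.nextA L' ^ 2)) •
    (s.nextA L' • primalPoint C γ (s.lam L') + s.A • s.xhat) = _
  rw [s.nextA_sq hL hL', smul_add, smul_smul, smul_smul]
  congr 2 <;> ring

/-- The left side of `gap_le` does not increase. With g = ∇φ(λ), the terms a'²‖g‖²/2 from the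
acceptance test and from ‖ζ'‖² cancel; convexity of f and f(x(λ)) = ⟨λ, g⟩ − φ(λ) handle x̂; what
remains is A times the tangent of φ at λ evaluated at η, which is at most Aφ(η). -/
theorem State.Estimate.next [NeZero N] (hγ : 0 < γ) {s : State N} (hs : s.Estimate C r c γ)
    {L' : ℝ} (hL' : 0 < L') {b : Block} (hacc : s.Accepts C r c γ L' b) :
    (s.next C r c γ L' b).Estimate C r c γ := by
  have hA := State.A_nonneg hs
  have ha := s.nextA_pos hL'
  have hA' : 0 < s.A + s.nextA L' := by linarith
  have hAn := s.A_next (C := C) (r := r) (c := c) (γ := γ) hs.L_pos hL' b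
  have hx := s.xhat_next (C := C) (r := r) (c := c) (γ := γ) hs.L_pos hL' b
  have hsq := s.nextA_sq hs.L_pos hL'
  have hone : s.nextA L' / (s.A + s.nextA L') + s.A / (s.A + s.nextA L') = 1 := by
    field_simp
    ring
  have hx1 := isJoint_primalPoint C γ (s.lam L')
  have hζ : (s.next C r c γ L' b).ζ = s.ζ - s.nextA L' • dualGrad C r c γ (s.lam L') := by
    rw [← gradient_dualObj]; rfl
  refine ⟨hL', ha.le, ?_, ?_, ?_, ?_⟩
  · have e : (s.A + s.nextA L') • marginals (s.next C r c γ L' b).xhat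
        = s.nextA L' • marginals (primalPoint C γ (s.lam L')) + s.A • marginals s.xhat := by
      rw [hx, marginals_add, marginals_smul, marginals_smul, smul_add, smul_smul, smul_smul,
        mul_div_cancel₀ _ hA'.ne', mul_div_cancel₀ _ hA'.ne']
    have e2 : -((s.A + s.nextA L') * γ) • (marginals (s.next C r c γ L' b).xhat - mkDual r c)
        = -γ • ((s.A + s.nextA L') • marginals (s.next C r c γ L' b).xhat
          - (s.A + s.nextA L') • mkDual r c) := by
      module
    rw [hAn, e2, e, hζ, hs.zeta_eq, dualGrad]
    module
  · rw [hAn, hζ]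
    have hf : (s.A + s.nextA L') * regObj C γ (s.next C r c γ L' b).xhat
        ≤ s.nextA L' * regObj C γ (primalPoint C γ (s.lam L')) + s.A * regObj C γ s.xhat := by
      have h := mul_le_mul_of_nonneg_left (regObj_convex (C := C) hγ hx1.1 hs.xhat_nonneg
        (by positivity) (by positivity) hone) hA'.le
      rw [hx]
      refine h.trans (le_of_eq ?_)
      field_simp
    have hφ : (s.A + s.nextA L') * dualObj C r c γ (s.next C r c γ L' b).η
        ≤ (s.A + s.nextA L') * dualObj C r c γ (s.lam L')
          - s.nextA L' ^ 2 * ‖dualGrad C r c γ (s.lam L')‖ ^ 2 / 2 := by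
      have h := hacc
      rw [State.Accepts, gradient_dualObj] at h
      have h2 := mul_le_mul_of_nonneg_left h hA'.le
      refine h2.trans (le_of_eq ?_)
      rw [mul_sub]
      congr 1
      rw [← hsq]
      field_simp
    have hreg := regObj_primalPoint C r c hγ (s.lam L')
    have htan := dualObj_tangent_le C r c hγ (s.lam L') s.η
    have hnorm : ‖s.ζ - s.nextA L' • dualGrad C r c γ (s.lam L')‖ ^ 2
        = ‖s.ζ‖ ^ 2 - 2 * (s.nextA L' * inner ℝ s.ζ (dualGrad C r c γ (s.lam L')))
          + s.nextA L' ^ 2 * ‖dualGrad C r c γ (s.lam L')‖ ^ 2 := by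
      rw [norm_sub_sq_real, inner_smul_right, norm_smul, Real.norm_eq_abs, mul_pow, sq_abs]
    -- λ is the average of ζ and η with weights a' and A. This choice converts the a'⟨λ − ζ, g⟩ left
    -- over in the sum into A⟨η − λ, g⟩.
    have hlam : (s.A + s.nextA L') * inner ℝ (s.lam L') (dualGrad C r c γ (s.lam L'))
        = s.nextA L' * inner ℝ s.ζ (dualGrad C r c γ (s.lam L'))
          + s.A * inner ℝ s.η (dualGrad C r c γ (s.lam L')) := by
      have e : (s.A + s.nextA L') • s.lam L' = s.nextA L' • s.ζ + s.A • s.η := by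
        rw [← hsq, State.lam, smul_add, smul_smul, smul_smul]
        have e1 : L' * s.nextA L' ^ 2 * (1 / (s.nextA L' * L')) = s.nextA L' := by
          field_simp
        have e2 : L' * s.nextA L' ^ 2 * (1 - 1 / (s.nextA L' * L')) = s.A := by
          rw [mul_sub, e1, hsq]
          ring
        rw [e1, e2]
      have := congrArg (fun z => inner ℝ z (dualGrad C r c γ (s.lam L'))) e
      simpa only [inner_add_left, inner_smul_left, RCLike.conj_to_real] using this
    have hgap := hs.gap_le
    rw [hreg] at hf
    rw [inner_sub_left] at htan
    have htan2 := mul_le_mul_of_nonneg_left htan hA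
    rw [hnorm]
    nlinarith
  · intro i j
    rw [hx]
    have h1 := mul_nonneg (div_nonneg ha.le hA'.le) (hx1.1 i j)
    have h2 := mul_nonneg (div_nonneg hA hA'.le) (hs.xhat_nonneg i j)
    simpa using add_nonneg h1 h2
  · intro _
    rw [hx]
    simp only [Matrix.add_apply, Matrix.smul_apply, smul_eq_mul, Finset.sum_add_distrib,
      ← Finset.mul_sum, hx1.2]
    -- In the first iteration A = 0: the matrix x̂⁰, whose mass is not one, enters with weight zero.
    rcases hA.eq_or_lt with h0 | h0
    · rw [← h0, zero_add, div_self ha.ne']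
      simp
    · rw [hs.xhat_sum h0, mul_one, mul_one, hone]

theorem State.Estimate.isJoint {s : State N} (hs : s.Estimate C r c γ) (hA : 0 < s.A) :
    IsJoint s.xhat := ⟨hs.xhat_nonneg, hs.xhat_sum hA⟩

/-- The duality gap is at most `-A_k γ² ‖𝐀 x̂ - b‖² / 2`. -/
theorem State.Estimate.gap_le' {s : State N} (hs : s.Estimate C r c γ) (hA : 0 < s.A) :
    dualObj C r c γ s.η + regObj C γ s.xhat
      ≤ -(s.A * γ ^ 2 * ‖marginals s.xhat - mkDual r c‖ ^ 2 / 2) := by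
  have h := hs.gap_le
  rw [hs.zeta_eq, norm_smul, Real.norm_eq_abs, mul_pow, sq_abs] at h
  refine le_of_mul_le_mul_left ?_ hA
  nlinarith

/-! ### Quadratic growth of the weights -/

/-- The upper bounds of `L_k / γ`. -/
def lipBound : ℕ → ℝ
  | 0 => 16
  | 1 => 8
  | 2 => 4
  | _ => 2

/-- The lower bounds of `8 γ A_k`. -/
def weightBound : ℕ → ℝ
  | 0 => 0
  | 1 => 1
  | 2 => 3
  | k => (k : ℝ) ^ 2

/-- The growth of the weights after `k` iterations. -/
structure State.Growth (γ : ℝ) (k : ℕ) (s : State N) : Prop where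
  L_le : s.L ≤ lipBound k * γ
  le_A : weightBound k ≤ 8 * γ * s.A

theorem State.growth_init {L₀ : ℝ} (hL : L₀ ≤ 16 * γ) : (State.init N L₀).Growth γ 0 :=
  ⟨hL, by simp [weightBound, State.init, State.A]⟩

/-- Matches the recursion L_{k+1} ≤ max(L_k/2, 2γ): from 16γ, three iterations reach the permanent
bound 2γ. -/
theorem max_lipBound_le (k : ℕ) : max (lipBound k / 2) 2 ≤ lipBound (k + 1) := by
  rcases k with _ | _ | _ | k
  iterate 3 norm_num [lipBound]
  change max ((2 : ℝ) / 2) 2 ≤ 2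
  norm_num

theorem lipBound_pos (k : ℕ) : 0 < lipBound k := by
  rcases k with _ | _ | _ | k
  iterate 3 norm_num [lipBound]
  exact two_pos (α := ℝ)

theorem weightBound_nonneg (k : ℕ) : 0 ≤ weightBound k := by
  rcases k with _ | _ | _ | k <;> simp only [weightBound] <;> positivity

/-- The right side is the recursion for 8γA_k at the largest allowed L. From 1 and L = 4γ it only
yields 2 + √3 < 4, so the bound k² is unavailable at k = 2; the value 3 suffices, because 3 + 2 +
√16 = 9 restores k² at k = 3. -/
theorem weightBound_step (k : ℕ) : weightBound (k + 1) ≤ weightBound k + 4 / lipBound (k + 1)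
    + √(16 / lipBound (k + 1) ^ 2 + 8 * weightBound k / lipBound (k + 1)) := by
  have key : ∀ {x y z : ℝ}, z - x ≤ √y → z ≤ x + √y := fun h => by linarith
  rcases k with _ | _ | _ | k
  · refine key (Real.le_sqrt_of_sq_le ?_)
    norm_num [lipBound, weightBound]
  · refine key (Real.le_sqrt_of_sq_le ?_)
    norm_num [lipBound, weightBound]
  · refine key (Real.le_sqrt_of_sq_le ?_)
    norm_num [lipBound, weightBound]
  · refine key (Real.le_sqrt_of_sq_le ?_)
    simp only [lipBound, weightBound]
    push_cast
    have : (0 : ℝ) ≤ k := k.cast_nonneg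
    nlinarith

theorem State.Growth.next (hγ : 0 < γ) {k : ℕ} {s : State N} (hs : s.Estimate C r c γ)
    (hk : s.Growth γ k) {L' : ℝ} (hL' : 0 < L') (hle : L' ≤ max (s.L / 2) (2 * γ)) (b : Block) :
    (s.next C r c γ L' b).Growth γ (k + 1) := by
  have hl := lipBound_pos (k + 1)
  have hb : L' ≤ lipBound (k + 1) * γ := by
    have h1 := max_lipBound_le k
    have h2 : s.L / 2 ≤ lipBound k / 2 * γ := by linarith [hk.L_le]
    refine hle.trans (max_le ?_ ?_)
    · exact h2.trans (mul_le_mul_of_nonneg_right ((le_max_left _ _).trans h1) hγ.le)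
    · exact mul_le_mul_of_nonneg_right ((le_max_right _ _).trans h1) hγ.le
  refine ⟨hb, (weightBound_step k).trans ?_⟩
  have hAn := s.A_next (C := C) (r := r) (c := c) (γ := γ) hs.L_pos hL' b
  rw [hAn]
  have hA := State.A_nonneg hs
  have hinv : 1 / lipBound (k + 1) ≤ γ / L' := by
    rw [div_le_div_iff₀ hl hL']; linarith
  have hw := hk.le_A
  have hw0 := weightBound_nonneg k
  -- Written in terms of γ/L', the increment 8γa' is visibly increasing in both γ/L' and A, so the
  -- lower bounds may be inserted for them.
  set l := lipBound (k + 1)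
  have e : 8 * γ * s.nextA L' = 4 * (γ / L')
      + √(16 * (γ / L') ^ 2 + 8 * (8 * γ * s.A) * (γ / L')) := by
    have e1 : 16 * (γ / L') ^ 2 + 8 * (8 * γ * s.A) * (γ / L')
        = (8 * γ) ^ 2 * (1 / (4 * L' ^ 2) + s.a ^ 2 * (s.L / L')) := by
      rw [State.A]
      field_simp
      ring
    rw [e1, Real.sqrt_mul (by positivity), Real.sqrt_sq (by positivity), State.nextA]
    field_simp
    ring
  have h1 : √(16 / l ^ 2 + 8 * weightBound k / l)
      ≤ √(16 * (γ / L') ^ 2 + 8 * (8 * γ * s.A) * (γ / L')) := by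
    refine Real.sqrt_le_sqrt ?_
    have e1 : 16 / l ^ 2 + 8 * weightBound k / l
        = 16 * (1 / l) ^ 2 + 8 * weightBound k * (1 / l) := by ring
    rw [e1]
    gcongr
  have h2 : 4 / l = 4 * (1 / l) := by ring
  rw [mul_add, e, h2]
  linarith

/-- The facts about the algorithm that hold after `k` iterations. -/
def State.Good (C : Matrix (Fin N) (Fin N) ℝ) (r c : Fin N → ℝ) (γ : ℝ) (k : ℕ)
    (s : State N) : Prop := s.Estimate C r c γ ∧ s.Growth γ k

theorem State.Good.iterate [NeZero N] (hγ : 0 < γ) (hr : IsHistogram r) (hc : IsHistogram c)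
    (hr0 : ∀ i, 0 < r i) (hc0 : ∀ j, 0 < c j) {k : ℕ} {s s' : State N}
    (hs : s.Good C r c γ k) (h : IsIteration C r c γ s s') : s'.Good C r c γ (k + 1) := by
  obtain ⟨n, b, hb, hrej, hacc, rfl⟩ := h
  have hL := hs.1.L_pos
  have hpos : 0 < 2 ^ n * (s.L / 2) := by positivity
  refine ⟨hs.1.next hγ hpos hacc, hs.2.next hγ hs.1 hpos ?_ _⟩
  -- Either the first candidate L/2 is accepted, or the preceding candidate was rejected, hence
  -- below γ, and the accepted one is below 2γ.
  rcases n with _ | n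
  · simp
  · refine le_max_of_le_right ?_
    have h1 : 2 ^ n * (s.L / 2) < γ := by
      by_contra! h
      exact hrej n (Nat.lt_succ_self n)
        (accepts_of_le C hγ hr hc hr0 hc0 s h (hb n (Nat.le_succ n)))
    rw [pow_succ]
    linarith

theorem State.Good.of_isRun [NeZero N] (hγ : 0 < γ) (hr : IsHistogram r) (hc : IsHistogram c)
    (hr0 : ∀ i, 0 < r i) (hc0 : ∀ j, 0 < c j) {L₀ : ℝ} (hL : 0 < L₀) (hL' : L₀ ≤ 16 * γ)
    {s : ℕ → State N} (h : IsRun C r c γ L₀ s) (k : ℕ) : (s k).Good C r c γ k := by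
  induction k with
  | zero => rw [h.1]; exact ⟨State.estimate_init C r c γ hL, State.growth_init hL'⟩
  | succ k ih => exact ih.iterate hγ hr hc hr0 hc0 (h.2 k)

/-- The factor 1/2 is needed only for k = 2, and is affordable in the residual and 1-norm rates but
not in the gap rate. -/
theorem weightBound_ge {k : ℕ} (hk : 1 ≤ k) : (k : ℝ) ^ 2 / 2 ≤ weightBound k := by
  rcases k with _ | _ | _ | k
  · omega
  · norm_num [weightBound]
  · norm_num [weightBound]
  · simp only [weightBound]
    linarith [sq_nonneg (((k + 1 + 1 + 1 : ℕ) : ℝ))]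

theorem weightBound_eq {k : ℕ} (hk : 1 ≤ k) (hk2 : k ≠ 2) : weightBound k = (k : ℝ) ^ 2 := by
  rcases k with _ | _ | _ | k
  · omega
  · norm_num [weightBound]
  · omega
  · rfl

theorem State.Growth.A_pos {k : ℕ} (hk : 1 ≤ k) {s : State N} (hγ : 0 < γ) (h : s.Growth γ k) :
    0 < s.A := by
  have h1 := (weightBound_ge hk).trans h.le_A
  have h2 : (1 : ℝ) ≤ k := by exact_mod_cast hk
  have h3 : 0 < 8 * γ * s.A := lt_of_lt_of_le (by positivity) h1
  exact pos_of_mul_pos_right h3 (by positivity)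

end Invariant

/-! ### Dual solutions -/

section DualSolution

variable {N : ℕ} {C : Matrix (Fin N) (Fin N) ℝ} {r c : Fin N → ℝ} {γ : ℝ}

theorem abs_le_maxAbs (C : Matrix (Fin N) (Fin N) ℝ) (i j : Fin N) : |C i j| ≤ maxAbs C :=
  le_ciSup (f := fun p : Fin N × Fin N => |C p.1 p.2|) (Set.finite_range _).bddAbove (i, j)

theorem le_maxAbs (C : Matrix (Fin N) (Fin N) ℝ) (i j : Fin N) : C i j ≤ maxAbs C :=
  (le_abs_self _).trans (abs_le_maxAbs C i j)

theorem maxAbs_nonneg (C : Matrix (Fin N) (Fin N) ℝ) : 0 ≤ maxAbs C :=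
  Real.iSup_nonneg fun _ => abs_nonneg _

theorem minEntry_le_left (r c : Fin N → ℝ) (i : Fin N) : minEntry r c ≤ r i :=
  (min_le_left _ _).trans (ciInf_le (Set.finite_range _).bddBelow i)

theorem minEntry_le_right (r c : Fin N → ℝ) (j : Fin N) : minEntry r c ≤ c j :=
  (min_le_right _ _).trans (ciInf_le (Set.finite_range _).bddBelow j)

theorem le_minEntry [NeZero N] {m : ℝ} (hr : ∀ i, m ≤ r i) (hc : ∀ j, m ≤ c j) :
    m ≤ minEntry r c := le_min (le_ciInf hr) (le_ciInf hc)

theorem minEntry_pos [NeZero N] (hr : ∀ i, 0 < r i) (hc : ∀ j, 0 < c j) : 0 < minEntry r c := by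
  obtain ⟨i, hi⟩ := Finite.exists_min r
  obtain ⟨j, hj⟩ := Finite.exists_min c
  exact (lt_min (hr i) (hc j)).trans_le (le_minEntry (fun k => (min_le_left _ _).trans (hi k))
    fun k => (min_le_right _ _).trans (hj k))

theorem IsHistogram.le_one {s : Fin N → ℝ} (hs : IsHistogram s) (i : Fin N) : s i ≤ 1 :=
  hs.2 ▸ Finset.single_le_sum (fun i _ => hs.1 i) (Finset.mem_univ i)

theorem log_minEntry_le [NeZero N] (hr : IsHistogram r) (hr0 : ∀ i, 0 < r i)
    (hc0 : ∀ j, 0 < c j) : Real.log (minEntry r c) ≤ -Real.log N := by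
  have hm := minEntry_pos hr0 hc0
  have hN : (0 : ℝ) < N := by exact_mod_cast Nat.pos_of_ne_zero (NeZero.ne N)
  have h : N * minEntry r c ≤ 1 := by
    rw [← hr.2]
    simpa using Finset.sum_le_sum fun i (_ : i ∈ Finset.univ) => minEntry_le_left r c i
  have h2 := Real.log_le_log (mul_pos hN hm) h
  rw [Real.log_mul hN.ne' hm.ne', Real.log_one] at h2
  linarith

theorem norm_le_of_abs_le {p : Dual N} {D : ℝ} (hD : 0 ≤ D) (h : ∀ s, |p s| ≤ D) :
    ‖p‖ ≤ √(2 * N) * D := by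
  refine abs_le_of_sq_le_sq' ?_ (by positivity) |>.2
  rw [mul_pow, Real.sq_sqrt (by positivity), EuclideanSpace.norm_sq_eq]
  calc ∑ s, ‖p s‖ ^ 2 ≤ ∑ _s : Fin N ⊕ Fin N, D ^ 2 :=
        Finset.sum_le_sum fun s _ => pow_le_pow_left₀ (norm_nonneg _) (h s) 2
    _ = 2 * N * D ^ 2 := by
      rw [Finset.sum_const, Finset.card_univ, Fintype.card_sum, Fintype.card_fin, nsmul_eq_mul]
      push_cast
      ring

/-- Subtract a constant from each block. -/
def shift (α β : ℝ) (p : Dual N) : Dual N :=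
  mkDual (fun i => p (Sum.inl i) - α) fun j => p (Sum.inr j) - β

theorem kernelB_shift (α β : ℝ) (p : Dual N) (i j : Fin N) :
    kernelB C γ (shift α β p) i j = Real.exp (-(α + β)) * kernelB C γ p i j := by
  rw [kernelB_apply, kernelB_apply, ← Real.exp_add]
  simp only [shift, mkDual_inl, mkDual_inr]
  congr 1
  ring

theorem mass_shift (α β : ℝ) (p : Dual N) :
    mass C γ (shift α β p) = Real.exp (-(α + β)) * mass C γ p := by
  simp only [mass, kernelB_shift, ← Finset.mul_sum]

theorem primalPoint_shift (α β : ℝ) (p : Dual N) :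
    primalPoint C γ (shift α β p) = primalPoint C γ p := by
  ext i j
  rw [primalPoint_apply, primalPoint_apply, mass_shift, kernelB_shift, mul_inv]
  field_simp

theorem dualObj_shift [NeZero N] (hr : IsHistogram r) (hc : IsHistogram c) (α β : ℝ)
    (p : Dual N) : dualObj C r c γ (shift α β p) = dualObj C r c γ p := by
  rw [dualObj, dualObj, mass_shift, Real.log_mul (Real.exp_pos _).ne' (mass_pos C γ p).ne',
    Real.log_exp]
  simp only [shift, mkDual_inl, mkDual_inr, sub_mul, Finset.sum_sub_distrib, ← Finset.mul_sum,
    hr.2, hc.2]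
  ring

theorem le_log_mass [NeZero N] (hγ : 0 < γ) (p : Dual N) (a b : Fin N) :
    p (Sum.inl a) + p (Sum.inr b) - maxAbs C / γ ≤ Real.log (mass C γ p) := by
  rw [Real.le_log_iff_exp_le (mass_pos C γ p)]
  have h1 : kernelB C γ p a b ≤ mass C γ p :=
    (Finset.single_le_sum (fun j _ => (kernelB_pos C γ p a j).le) (Finset.mem_univ b)).trans
      (Finset.single_le_sum (f := fun i => ∑ j, kernelB C γ p i j)
        (fun i _ => Finset.sum_nonneg fun j _ => (kernelB_pos C γ p i j).le) (Finset.mem_univ a))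
  refine le_trans ?_ h1
  rw [kernelB_apply, Real.exp_le_exp]
  have := div_le_div_of_nonneg_right (le_maxAbs C a b) hγ.le
  linarith

theorem mul_sub_le_of_isMax {s w : Fin N → ℝ} (hs : IsHistogram s) {a : Fin N}
    (ha : ∀ i, w i ≤ w a) (k : Fin N) : s k * (w a - w k) ≤ w a - ∑ i, w i * s i := by
  have h := Finset.single_le_sum (f := fun i => s i * (w a - w i))
    (fun i _ => mul_nonneg (hs.1 i) (sub_nonneg.2 (ha i))) (Finset.mem_univ k)
  refine h.trans (le_of_eq ?_)
  simp only [mul_comm (s _), sub_mul, Finset.sum_sub_distrib, ← Finset.mul_sum, hs.2, mul_one]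

/-- A single kernel entry, at the maxima of both blocks, gives ln mass ≥ max u + max v − ‖C‖/γ.
Subtracting the means ⟨u, r⟩ and ⟨v, c⟩ leaves at least the smallest weight times the oscillation of
either block. -/
theorem dualObj_coercive [NeZero N] (hγ : 0 < γ) (hr : IsHistogram r) (hc : IsHistogram c)
    (p : Dual N) (i k j l : Fin N) :
    γ * (minEntry r c * |p (Sum.inl i) - p (Sum.inl k)| - maxAbs C / γ) ≤ dualObj C r c γ p ∧
    γ * (minEntry r c * |p (Sum.inr j) - p (Sum.inr l)| - maxAbs C / γ) ≤ dualObj C r c γ p := by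
  obtain ⟨a, ha⟩ := Finite.exists_max fun i => p (Sum.inl i)
  obtain ⟨b, hb⟩ := Finite.exists_max fun j => p (Sum.inr j)
  have h1 := le_log_mass (C := C) hγ p a b
  have hu := fun k => mul_sub_le_of_isMax (w := fun i => p (Sum.inl i)) hr ha k
  have hv := fun k => mul_sub_le_of_isMax (w := fun i => p (Sum.inr i)) hc hb k
  have hu' : ∀ k, minEntry r c * (p (Sum.inl a) - p (Sum.inl k))
      ≤ p (Sum.inl a) - ∑ i, p (Sum.inl i) * r i := fun k =>
    (mul_le_mul_of_nonneg_right (minEntry_le_left r c k) (sub_nonneg.2 (ha k))).trans (hu k)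
  have hv' : ∀ k, minEntry r c * (p (Sum.inr b) - p (Sum.inr k))
      ≤ p (Sum.inr b) - ∑ i, p (Sum.inr i) * c i := fun k =>
    (mul_le_mul_of_nonneg_right (minEntry_le_right r c k) (sub_nonneg.2 (hb k))).trans (hv k)
  have hm : 0 ≤ minEntry r c :=
    le_minEntry (m := 0) hr.1 hc.1
  have hu0 := (mul_nonneg hm (sub_nonneg.2 (ha a))).trans (hu' a)
  have hv0 := (mul_nonneg hm (sub_nonneg.2 (hb b))).trans (hv' b)
  constructor
  · refine mul_le_mul_of_nonneg_left ?_ hγ.le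
    have h2 : minEntry r c * |p (Sum.inl i) - p (Sum.inl k)|
        ≤ p (Sum.inl a) - ∑ i, p (Sum.inl i) * r i := by
      rcases abs_cases (p (Sum.inl i) - p (Sum.inl k)) with ⟨h, _⟩ | ⟨h, _⟩ <;> rw [h]
      · exact le_trans (mul_le_mul_of_nonneg_left (by linarith [ha i]) hm) (hu' k)
      · exact le_trans (mul_le_mul_of_nonneg_left (by linarith [ha k]) hm) (hu' i)
    linarith
  · refine mul_le_mul_of_nonneg_left ?_ hγ.le
    have h2 : minEntry r c * |p (Sum.inr j) - p (Sum.inr l)|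
        ≤ p (Sum.inr b) - ∑ i, p (Sum.inr i) * c i := by
      rcases abs_cases (p (Sum.inr j) - p (Sum.inr l)) with ⟨h, _⟩ | ⟨h, _⟩ <;> rw [h]
      · exact le_trans (mul_le_mul_of_nonneg_left (by linarith [hb j]) hm) (hv' l)
      · exact le_trans (mul_le_mul_of_nonneg_left (by linarith [hb l]) hm) (hv' j)
    linarith

theorem exists_isMin_dualObj [NeZero N] (hγ : 0 < γ) (hr : IsHistogram r) (hc : IsHistogram c)
    (hr0 : ∀ i, 0 < r i) (hc0 : ∀ j, 0 < c j) :
    ∃ y : Dual N, ∀ q, dualObj C r c γ y ≤ dualObj C r c γ q := by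
  have hm := minEntry_pos hr0 hc0
  -- Coercivity makes D a bound for the oscillation on the sublevel set of φ(0).
  set D := (dualObj C r c γ 0 / γ + maxAbs C / γ) / minEntry r c with hDdef
  have hosc : ∀ q : Dual N, dualObj C r c γ q ≤ dualObj C r c γ 0 → ∀ i k : Fin N,
      |q (Sum.inl i) - q (Sum.inl k)| ≤ D ∧ |q (Sum.inr i) - q (Sum.inr k)| ≤ D := by
    intro q hq i k
    have h := dualObj_coercive (C := C) hγ hr hc q i k i k
    have key : ∀ x : ℝ, γ * (minEntry r c * x - maxAbs C / γ) ≤ dualObj C r c γ q → x ≤ D := by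
      intro x hx
      rw [hDdef, le_div_iff₀ hm]
      have h3 := hx.trans hq
      rw [mul_comm, ← le_div_iff₀ hγ] at h3
      linarith
    exact ⟨key _ h.1, key _ h.2⟩
  have hD : 0 ≤ D := (abs_nonneg _).trans (hosc 0 le_rfl 0 0).1
  have hcont : Continuous (dualObj C r c γ) := continuous_iff_continuousAt.2 fun p =>
    (hasGradientAt_dualObj C r c γ p).differentiableAt.continuousAt
  obtain ⟨y, hy, hmin⟩ := (isCompact_closedBall (0 : Dual N) (√(2 * N) * D)).exists_isMinOn
    ⟨0, Metric.mem_closedBall_self (by positivity)⟩ hcont.continuousOn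
  have h0 : dualObj C r c γ y ≤ dualObj C r c γ 0 :=
    hmin (Metric.mem_closedBall_self (by positivity))
  refine ⟨y, fun q => ?_⟩
  rcases le_total (dualObj C r c γ q) (dualObj C r c γ 0) with hq | hq
  -- φ is not coercive in the shift directions; shifting so that the entries of index 0 vanish turns
  -- the oscillation bound into membership in the ball.
  · rw [← dualObj_shift hr hc (q (Sum.inl 0)) (q (Sum.inr 0)) q]
    refine hmin ?_
    rw [mem_closedBall_zero_iff]
    refine norm_le_of_abs_le hD ?_
    rintro (i | j)
    · exact (hosc q hq i 0).1
    · exact (hosc q hq j 0).2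
  · exact h0.trans hq

theorem marginals_of_isMin [NeZero N] (hγ : 0 < γ) {y : Dual N}
    (hy : ∀ q, dualObj C r c γ y ≤ dualObj C r c γ q) :
    marginals (primalPoint C γ y) = mkDual r c := by
  have h : fderiv ℝ (dualObj C r c γ) y = 0 :=
    IsLocalMin.fderiv_eq_zero (Filter.Eventually.of_forall hy)
  have h2 : dualGrad C r c γ y = 0 := by
    rw [← gradient_dualObj, gradient, h, map_zero]
  rw [dualGrad, smul_eq_zero] at h2
  exact sub_eq_zero.1 (h2.resolve_left hγ.ne')

/-- Comparing rows k and i of the optimal plan entrywise gives r_k ≤ exp(u_k − u_i + ‖C‖/γ) r_i.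
Then r_i ≤ 1, r_k ≥ min{r, c} and a logarithm finish; columns are analogous. -/
theorem oscillation_le [NeZero N] (hγ : 0 < γ) (hC : ∀ i j, 0 ≤ C i j) (hr : IsHistogram r)
    (hc : IsHistogram c) (hr0 : ∀ i, 0 < r i) (hc0 : ∀ j, 0 < c j) {y : Dual N}
    (hy : marginals (primalPoint C γ y) = mkDual r c) (i k : Fin N) :
    y (Sum.inl i) - y (Sum.inl k) ≤ maxAbs C / γ - Real.log (minEntry r c) ∧
    y (Sum.inr i) - y (Sum.inr k) ≤ maxAbs C / γ - Real.log (minEntry r c) := by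
  have hm := minEntry_pos hr0 hc0
  have hCb : ∀ i j i' j', C i j / γ - C i' j' / γ ≤ maxAbs C / γ := fun i j i' j' => by
    have h1 := div_le_div_of_nonneg_right (le_maxAbs C i j) hγ.le
    have h2 := div_nonneg (hC i' j') hγ.le
    linarith
  have key : ∀ x z d : ℝ, minEntry r c ≤ x → z ≤ 1 →
      x ≤ Real.exp (d + maxAbs C / γ) * z → -d ≤ maxAbs C / γ - Real.log (minEntry r c) := by
    intro x z d hx hz hxz
    have h1 : minEntry r c ≤ Real.exp (d + maxAbs C / γ) :=
      hx.trans (hxz.trans (mul_le_of_le_one_right (Real.exp_pos _).le hz))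
    have h2 := (Real.log_le_iff_le_exp hm).2 h1
    linarith
  have hrow : ∀ i, ∑ j, primalPoint C γ y i j = r i := fun i => by
    simpa using congrArg (fun p : Dual N => p (Sum.inl i)) hy
  have hcol : ∀ j, ∑ i, primalPoint C γ y i j = c j := fun j => by
    simpa using congrArg (fun p : Dual N => p (Sum.inr j)) hy
  have hmi := inv_nonneg.2 (mass_pos C γ y).le
  constructor
  · have h := key (r k) (r i) (y (Sum.inl k) - y (Sum.inl i)) (minEntry_le_left r c k)
      (hr.le_one i) (by
        rw [← hrow, ← hrow, Finset.mul_sum]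
        refine Finset.sum_le_sum fun j _ => ?_
        rw [primalPoint_apply, primalPoint_apply, mul_left_comm]
        refine mul_le_mul_of_nonneg_left ?_ hmi
        rw [kernelB_apply, kernelB_apply, ← Real.exp_add, Real.exp_le_exp]
        linarith [hCb i j k j])
    linarith
  · have h := key (c k) (c i) (y (Sum.inr k) - y (Sum.inr i)) (minEntry_le_right r c k)
      (hc.le_one i) (by
        rw [← hcol, ← hcol, Finset.mul_sum]
        refine Finset.sum_le_sum fun j _ => ?_
        rw [primalPoint_apply, primalPoint_apply, mul_left_comm]
        refine mul_le_mul_of_nonneg_left ?_ hmi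
        rw [kernelB_apply, kernelB_apply, ← Real.exp_add, Real.exp_le_exp]
        linarith [hCb j i j k])
    linarith

theorem exists_abs_sub_le [NeZero N] {w : Fin N → ℝ} {D : ℝ} (h : ∀ i k, w i - w k ≤ D) :
    ∃ α, ∀ i, |w i - α| ≤ D / 2 := by
  obtain ⟨a, ha⟩ := Finite.exists_max w
  obtain ⟨b, hb⟩ := Finite.exists_min w
  refine ⟨(w a + w b) / 2, fun i => abs_le.2 ⟨?_, ?_⟩⟩ <;> linarith [ha i, hb i, h a b]

/-- There is a dual solution of norm at most `√(N/2) (‖C‖_∞ / γ - ln min {r_i, c_j})`. -/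
theorem exists_dual_solution [NeZero N] (hγ : 0 < γ) (hC : ∀ i j, 0 ≤ C i j) (hr : IsHistogram r)
    (hc : IsHistogram c) (hr0 : ∀ i, 0 < r i) (hc0 : ∀ j, 0 < c j) :
    ∃ y : Dual N, marginals (primalPoint C γ y) = mkDual r c ∧
      ‖y‖ ≤ √((N : ℝ) / 2) * (maxAbs C / γ - Real.log (minEntry r c)) := by
  obtain ⟨y, hy⟩ := exists_isMin_dualObj (C := C) hγ hr hc hr0 hc0
  have hy' := marginals_of_isMin hγ hy
  have hosc := oscillation_le hγ hC hr hc hr0 hc0 hy'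
  -- Centering each block at its midrange halves the bound on its entries: √(2N)/2 = √(N/2).
  obtain ⟨α, hα⟩ := exists_abs_sub_le fun i k => (hosc i k).1
  obtain ⟨β, hβ⟩ := exists_abs_sub_le fun i k => (hosc i k).2
  refine ⟨shift α β y, by rw [primalPoint_shift, hy'], ?_⟩
  have hD := (abs_nonneg _).trans (hα 0)
  have h := norm_le_of_abs_le (p := shift α β y) hD (by
    rintro (i | j)
    · exact hα i
    · exact hβ j)
  refine h.trans (le_of_eq ?_)
  have e : √(2 * N : ℝ) = 2 * √((N : ℝ) / 2) := by
    rw [show (2 * N : ℝ) = 2 ^ 2 * (N / 2) by ring, Real.sqrt_mul (by norm_num),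
      Real.sqrt_sq (by norm_num)]
  rw [e]
  ring

end DualSolution

/-! ### Rates of convergence -/

section Rates

variable {N : ℕ} {C : Matrix (Fin N) (Fin N) ℝ} {r c : Fin N → ℝ} {γ : ℝ}

/-- An a priori bound, used for the gap rate at k = 2. In each block (p − q)² ≤ p + q entrywise for
numbers in [0, 1]. -/
theorem residual_le_two {X : Matrix (Fin N) (Fin N) ℝ} (hX : IsJoint X) (hr : IsHistogram r)
    (hc : IsHistogram c) : ‖marginals X - mkDual r c‖ ≤ 2 := by
  have key : ∀ p q : Fin N → ℝ, IsHistogram p → IsHistogram q → ∑ i, (p i - q i) ^ 2 ≤ 2 := by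
    intro p q hp hq
    calc ∑ i, (p i - q i) ^ 2 ≤ ∑ i, (p i + q i) := Finset.sum_le_sum fun i _ => by
          have h1 := mul_nonneg (hp.1 i) (sub_nonneg.2 (hp.le_one i))
          have h2 := mul_nonneg (hq.1 i) (sub_nonneg.2 (hq.le_one i))
          have h3 := mul_nonneg (hp.1 i) (hq.1 i)
          nlinarith
      _ = 2 := by rw [Finset.sum_add_distrib, hp.2, hq.2]; norm_num
  have h1 := key (fun i => ∑ j, X i j) r ⟨fun i => Finset.sum_nonneg fun j _ => hX.1 i j, hX.2⟩ hr
  have h2 := key (fun j => ∑ i, X i j) c ⟨fun j => Finset.sum_nonneg fun i _ => hX.1 i j, by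
    rw [← hX.2]; exact Finset.sum_comm⟩ hc
  have h3 : ‖marginals X - mkDual r c‖ ^ 2 ≤ 2 ^ 2 := by
    rw [normSq_dual]
    simp only [blockSq, PiLp.sub_apply, marginals_inl, marginals_inr, mkDual_inl, mkDual_inr]
    linarith
  exact abs_le_of_sq_le_sq' h3 (by norm_num) |>.2

variable [NeZero N]

theorem residual_eq_zero_of_one {X : Matrix (Fin N) (Fin N) ℝ} (hX : IsJoint X)
    (hr : IsHistogram r) (hc : IsHistogram c) (hN : N = 1) :
    ‖marginals X - mkDual r c‖ = 0 := by
  subst hN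
  have h1 := hX.2
  have h2 := hr.2
  have h3 := hc.2
  simp only [Finset.univ_unique, Fin.default_eq_zero, Finset.sum_singleton, Fin.isValue] at h1 h2 h3
  rw [norm_eq_zero]
  ext (i | j)
  · have : i = 0 := Subsingleton.elim _ _
    simp [this, h1, h2]
  · have : j = 0 := Subsingleton.elim _ _
    simp [this, h1, h3]

/-- The basic estimates behind the rates. -/
theorem State.Estimate.bounds (hγ : 0 < γ) {s : State N} (hs : s.Estimate C r c γ)
    (hA : 0 < s.A) {y : Dual N} (hy : marginals (primalPoint C γ y) = mkDual r c) :
    s.A * γ * ‖marginals s.xhat - mkDual r c‖ ≤ 2 * ‖y‖ ∧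
    |dualObj C r c γ s.η + regObj C γ s.xhat|
      ≤ γ * ‖y‖ * ‖marginals s.xhat - mkDual r c‖ ∧
    l1Norm (s.xhat - primalPoint C γ y) ^ 2 ≤ 2 * ‖y‖ * ‖marginals s.xhat - mkDual r c‖ := by
  have hX := hs.isJoint hA
  set e := marginals s.xhat - mkDual r c with he
  have h1 := regObj_add_dualObj C r c hγ hX y
  have h2 := pinsker_matrix hX (isJoint_primalPoint C γ y) (primalPoint_pos C γ y)
  -- Since ∇φ(y) = 0, this says φ(y) ≤ φ(η).
  have h3 := dualObj_tangent_le C r c hγ y s.η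
  have h4 : dualGrad C r c γ y = 0 := by rw [dualGrad, hy, sub_self, smul_zero]
  rw [h4, inner_zero_right, add_zero] at h3
  have h5 := hs.gap_le' hA
  rw [← he] at h1 h5
  have h6 : -(‖y‖ * ‖e‖) ≤ inner ℝ y e := (abs_le.1 (abs_real_inner_le_norm y e)).1
  have h7 := mul_le_mul_of_nonneg_left h6 hγ.le
  have h8 := mul_le_mul_of_nonneg_left h2 hγ.le
  have h9 : 0 ≤ s.A * γ ^ 2 * ‖e‖ ^ 2 / 2 := by positivity
  have h10 : 0 ≤ γ * (l1Norm (s.xhat - primalPoint C γ y) ^ 2 / 2) := by positivity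
  refine ⟨?_, ?_, ?_⟩
  · rcases (norm_nonneg e).eq_or_lt with h0 | h0
    · rw [← h0]
      simp
    -- The upper and lower bounds of the gap are compared; one factor γ‖e‖ then cancels.
    · have h11 : s.A * γ ^ 2 * ‖e‖ ^ 2 / 2 ≤ γ * (‖y‖ * ‖e‖) := by linarith
      refine le_of_mul_le_mul_left ?_ (mul_pos hγ h0)
      nlinarith
  · rw [abs_le]
    constructor <;> nlinarith [mul_nonneg (mul_nonneg hγ.le (norm_nonneg y)) (norm_nonneg e)]
  · refine le_of_mul_le_mul_left ?_ hγ
    nlinarith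

theorem State.Good.rates (hγ : 0 < γ) (hr : IsHistogram r) (hc : IsHistogram c)
    (hr0 : ∀ i, 0 < r i) (hc0 : ∀ j, 0 < c j) {k : ℕ} (hk : 1 ≤ k) {s : State N}
    (hs : s.Good C r c γ k) {y : Dual N} (hy : marginals (primalPoint C γ y) = mkDual r c)
    (hyn : ‖y‖ ≤ √((N : ℝ) / 2) * (maxAbs C / γ - Real.log (minEntry r c))) :
    ‖marginals s.xhat - mkDual r c‖ ≤
      64 * √((N : ℝ) / 2) * (maxAbs C - γ / 2 * Real.log (minEntry r c)) / (γ * (k : ℝ) ^ 2) ∧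
    |dualObj C r c γ s.η + regObj C γ s.xhat| ≤
      32 * (N : ℝ) * (maxAbs C - γ / 2 * Real.log (minEntry r c)) ^ 2 / (γ * (k : ℝ) ^ 2) ∧
    l1Norm (s.xhat - primalPoint C γ y) ≤
      16 * √((N : ℝ) / 2) * (maxAbs C - γ / 2 * Real.log (minEntry r c)) / (γ * (k : ℝ)) := by
  have hA := hs.2.A_pos hk hγ
  obtain ⟨h1, h2, h3⟩ := hs.1.bounds hγ hA hy
  have hX := hs.1.isJoint hA
  have hw := (weightBound_ge hk).trans hs.2.le_A
  have hk0 : (0 : ℝ) < k := by exact_mod_cast hk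
  have hN0 : 0 < N := Nat.pos_of_ne_zero (NeZero.ne N)
  have hlogm := log_minEntry_le hr hr0 hc0
  have hlogN : 0 ≤ Real.log N := Real.log_natCast_nonneg N
  set W := √((N : ℝ) / 2) with hW
  have hW2 : W ^ 2 = N / 2 := Real.sq_sqrt (by positivity)
  have hW0 : 0 ≤ W := Real.sqrt_nonneg _
  set ρ := maxAbs C - γ / 2 * Real.log (minEntry r c) with hρ
  have hMn := maxAbs_nonneg C
  have hρ1 : γ / 2 * Real.log N ≤ ρ := by
    have := mul_le_mul_of_nonneg_left hlogm (by positivity : 0 ≤ γ / 2)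
    linarith
  have hρ0 : 0 ≤ ρ := le_trans (by positivity) hρ1
  -- Half of the logarithm in ρ suffices, because ‖C‖ ≤ 2‖C‖.
  have hR : γ * ‖y‖ ≤ 2 * (W * ρ) := by
    have h4 := mul_le_mul_of_nonneg_left hyn hγ.le
    have h5 : γ * (W * (maxAbs C / γ - Real.log (minEntry r c))) ≤ 2 * (W * ρ) := by
      have e : γ * (W * (maxAbs C / γ - Real.log (minEntry r c)))
          = W * (maxAbs C - γ * Real.log (minEntry r c)) := by
        field_simp
      rw [e, hρ]
      have := mul_nonneg hW0 hMn
      nlinarith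
    exact h4.trans h5
  set e := ‖marginals s.xhat - mkDual r c‖ with he
  have he0 : 0 ≤ e := norm_nonneg _
  have hy0 := norm_nonneg y
  have hek : (k : ℝ) ^ 2 * e ≤ 32 * ‖y‖ := by
    have := mul_le_mul_of_nonneg_right hw he0
    linarith
  refine ⟨?_, ?_, ?_⟩
  · rw [le_div_iff₀ (by positivity)]
    have := mul_le_mul_of_nonneg_left hek hγ.le
    linarith
  · refine h2.trans ?_
    rw [le_div_iff₀ (by positivity)]
    -- The weight bound 3 < 4 is too weak here. Instead ‖e‖ ≤ 2, W ≤ N/2 and ρ ≥ (γ/2) ln N ≥ γ/4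
    -- for N ≥ 2 are enough; for N = 1 the residual vanishes.
    by_cases hk2 : k = 2
    · subst hk2
      have hfin : W * γ * e ≤ 4 * N * ρ := by
        rcases Nat.lt_or_ge 1 N with hN | hN
        · have he2 : e ≤ 2 := residual_le_two hX hr hc
          have hN2 : (2 : ℝ) ≤ N := by exact_mod_cast hN
          have hWN : W ≤ N / 2 := by
            rw [hW, Real.sqrt_le_left (by positivity)]
            nlinarith
          have hlog : 1 / 2 ≤ Real.log N :=
            (by linarith [Real.log_two_gt_d9] : (1 : ℝ) / 2 ≤ Real.log 2).trans
              (Real.log_le_log (by norm_num) hN2)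
          have hργ : γ / 4 ≤ ρ := by nlinarith
          have h6 : W * γ ≤ 2 * N * ρ := by
            have h7 := mul_le_mul hWN hργ (by positivity) (by positivity)
            linarith
          calc W * γ * e ≤ W * γ * 2 := mul_le_mul_of_nonneg_left he2 (by positivity)
            _ ≤ _ := by linarith
        · have h0 : e = 0 := residual_eq_zero_of_one hX hr hc (by omega)
          rw [h0, mul_zero]
          positivity
      have h8 := mul_le_mul_of_nonneg_right hR (mul_nonneg hγ.le he0)
      have h9 := mul_le_mul_of_nonneg_left hfin hρ0
      push_cast
      linarith
    · have hw2 : (k : ℝ) ^ 2 ≤ 8 * γ * s.A := (weightBound_eq hk hk2) ▸ hs.2.le_A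
      have hek2 : (k : ℝ) ^ 2 * e ≤ 16 * ‖y‖ := by
        have := mul_le_mul_of_nonneg_right hw2 he0
        linarith
      have h8 : (γ * ‖y‖) ^ 2 ≤ 2 * N * ρ ^ 2 := by
        have := pow_le_pow_left₀ (by positivity) hR 2
        have e2 : (2 * (W * ρ)) ^ 2 = 2 * N * ρ ^ 2 := by
          rw [mul_pow, mul_pow, hW2]; ring
        linarith
      have h9 := mul_le_mul_of_nonneg_left hek2 (by positivity : 0 ≤ γ ^ 2 * ‖y‖)
      linarith
  · rw [le_div_iff₀ (by positivity)]
    have h8 : (l1Norm (s.xhat - primalPoint C γ y) * k) ^ 2 ≤ (8 * ‖y‖) ^ 2 := by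
      have h9 := mul_le_mul_of_nonneg_right h3 (sq_nonneg (k : ℝ))
      have h10 := mul_le_mul_of_nonneg_left hek hy0
      linarith
    have h11 : l1Norm (s.xhat - primalPoint C γ y) * k ≤ 8 * ‖y‖ :=
      abs_le_of_sq_le_sq' h8 (by positivity) |>.2
    have := mul_le_mul_of_nonneg_left h11 hγ.le
    linarith

theorem convergence_rates (hγ : 0 < γ) (hC : ∀ i j, 0 ≤ C i j) (hr : IsHistogram r)
    (hc : IsHistogram c) (hr0 : ∀ i, 0 < r i) (hc0 : ∀ j, 0 < c j) {L₀ : ℝ} (hL : 0 < L₀)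
    (hL' : L₀ ≤ 16 * γ) :
    (∃ s : ℕ → State N, IsRun C r c γ L₀ s) ∧
    ∃ Xopt : Matrix (Fin N) (Fin N) ℝ,
      (∀ Y, IsRegSolution C r c γ Y ↔ Y = Xopt) ∧
      ∀ s : ℕ → State N, IsRun C r c γ L₀ s → ∀ k : ℕ, 1 ≤ k →
        ‖marginals (s k).xhat - mkDual r c‖ ≤
          64 * √((N : ℝ) / 2) * (maxAbs C - γ / 2 * Real.log (minEntry r c)) /
            (γ * (k : ℝ) ^ 2) ∧
        |dualObj C r c γ (s k).η + regObj C γ (s k).xhat| ≤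
          32 * (N : ℝ) * (maxAbs C - γ / 2 * Real.log (minEntry r c)) ^ 2 / (γ * (k : ℝ) ^ 2) ∧
        l1Norm ((s k).xhat - Xopt) ≤
          16 * √((N : ℝ) / 2) * (maxAbs C - γ / 2 * Real.log (minEntry r c)) / (γ * (k : ℝ)) := by
  refine ⟨exists_isRun C hγ hr hc hr0 hc0 hL, ?_⟩
  obtain ⟨y, hy, hyn⟩ := exists_dual_solution hγ hC hr hc hr0 hc0
  exact ⟨primalPoint C γ y, isRegSolution_primalPoint_iff C r c hγ hr hy, fun s hs k hk =>
    (State.Good.of_isRun hγ hr hc hr0 hc0 hL hL' hs k).rates hγ hr hc hr0 hc0 hk hy hyn⟩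

end Rates

/-! ### Rounding to the transport polytope -/

section Rounding

variable {N : ℕ} {C : Matrix (Fin N) (Fin N) ℝ} {r c : Fin N → ℝ}

/-- Scale down the rows that are too heavy. -/
def scaleRows (r : Fin N → ℝ) (F : Matrix (Fin N) (Fin N) ℝ) : Matrix (Fin N) (Fin N) ℝ :=
  Matrix.of fun i j => min (r i / ∑ j, F i j) 1 * F i j

/-- Scale down the columns that are too heavy. -/
def scaleCols (c : Fin N → ℝ) (F : Matrix (Fin N) (Fin N) ℝ) : Matrix (Fin N) (Fin N) ℝ :=
  Matrix.of fun i j => F i j * min (c j / ∑ i, F i j) 1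

/-- The rank-one correction of the marginals. -/
def correct (r c : Fin N → ℝ) (F : Matrix (Fin N) (Fin N) ℝ) : Matrix (Fin N) (Fin N) ℝ :=
  if ∑ i, |r i - ∑ j, F i j| ≤ 0 then F else Matrix.of fun i j =>
    F i j + (r i - ∑ j, F i j) * (c j - ∑ i, F i j) / ∑ i, |r i - ∑ j, F i j|

theorem min_div_mul_le {a R : ℝ} (ha : 0 ≤ a) (hR : 0 ≤ R) : min (a / R) 1 * R ≤ a := by
  rcases hR.eq_or_lt with h | h
  · rw [← h, mul_zero]; exact ha
  · calc min (a / R) 1 * R ≤ a / R * R := mul_le_mul_of_nonneg_right (min_le_left _ _) hR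
      _ = a := div_mul_cancel₀ _ h.ne'

theorem sub_min_div_mul_le {a R : ℝ} (hR : 0 ≤ R) : R - min (a / R) 1 * R ≤ max (R - a) 0 := by
  rcases hR.eq_or_lt with h | h
  · rw [← h]; simp
  · rcases min_choice (a / R) 1 with h1 | h1 <;> rw [h1]
    · rw [div_mul_cancel₀ _ h.ne']; exact le_max_left _ _
    · simp

theorem sum_max_eq_half {x : Fin N → ℝ} (hx : ∑ i, x i = 0) :
    ∑ i, max (x i) 0 = (∑ i, |x i|) / 2 := by
  have e : ∀ t : ℝ, max t 0 = (t + |t|) / 2 := fun t => by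
    rcases le_total t 0 with h | h
    · rw [max_eq_right h, abs_of_nonpos h]; ring
    · rw [max_eq_left h, abs_of_nonneg h]; ring
  simp only [e]
  rw [← Finset.sum_div, Finset.sum_add_distrib, hx, zero_add]

theorem min_div_nonneg {a R : ℝ} (ha : 0 ≤ a) (hR : 0 ≤ R) : 0 ≤ min (a / R) 1 :=
  le_min (div_nonneg ha hR) zero_le_one

/-- The properties of a matrix below a joint distribution `F` that is obtained by scaling. -/
theorem scaled_properties (hr : IsHistogram r) (hc : IsHistogram c)
    {F : Matrix (Fin N) (Fin N) ℝ} (hF : IsJoint F) :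
    (∀ i j, 0 ≤ scaleCols c (scaleRows r F) i j) ∧
    (∀ i j, scaleCols c (scaleRows r F) i j ≤ F i j) ∧
    (∀ i, ∑ j, scaleCols c (scaleRows r F) i j ≤ r i) ∧
    (∀ j, ∑ i, scaleCols c (scaleRows r F) i j ≤ c j) ∧
    1 - ∑ i, ∑ j, scaleCols c (scaleRows r F) i j
      ≤ (∑ i, |∑ j, F i j - r i| + ∑ j, |∑ i, F i j - c j|) / 2 := by
  have hR : ∀ i, 0 ≤ ∑ j, F i j := fun i => Finset.sum_nonneg fun j _ => hF.1 i j
  set F' := scaleRows r F with hF'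
  have h0' : ∀ i j, 0 ≤ F' i j := fun i j =>
    mul_nonneg (min_div_nonneg (hr.1 i) (hR i)) (hF.1 i j)
  have hle' : ∀ i j, F' i j ≤ F i j := fun i j =>
    mul_le_of_le_one_left (hF.1 i j) (min_le_right _ _)
  have hK : ∀ j, 0 ≤ ∑ i, F' i j := fun j => Finset.sum_nonneg fun i _ => h0' i j
  have hrow' : ∀ i, ∑ j, F' i j = min (r i / ∑ j, F i j) 1 * ∑ j, F i j := fun i => by
    rw [Finset.mul_sum]; rfl
  have hcol : ∀ j, ∑ i, scaleCols c F' i j = min (c j / ∑ i, F' i j) 1 * ∑ i, F' i j := fun j => by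
    rw [mul_comm, Finset.sum_mul]; rfl
  have hle : ∀ i j, scaleCols c F' i j ≤ F' i j := fun i j =>
    mul_le_of_le_one_right (h0' i j) (min_le_right _ _)
  refine ⟨fun i j => mul_nonneg (h0' i j) (min_div_nonneg (hc.1 j) (hK j)),
    fun i j => (hle i j).trans (hle' i j), fun i => ?_, fun j => ?_, ?_⟩
  · refine (Finset.sum_le_sum fun j _ => hle i j).trans ?_
    rw [hrow']
    exact min_div_mul_le (hr.1 i) (hR i)
  · rw [hcol]
    exact min_div_mul_le (hc.1 j) (hK j)
  -- Row scaling removes only the positive parts of the row excesses. These excesses sum to zero, so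
  -- the positive parts make up half of the 1-norm.
  · have h1 : ∑ i, ∑ j, F i j - ∑ i, ∑ j, F' i j ≤ (∑ i, |∑ j, F i j - r i|) / 2 := by
      rw [← sum_max_eq_half (x := fun i => ∑ j, F i j - r i)
        (by rw [Finset.sum_sub_distrib, hF.2, hr.2, sub_self]), ← Finset.sum_sub_distrib]
      refine Finset.sum_le_sum fun i _ => ?_
      rw [hrow']
      exact sub_min_div_mul_le (hR i)
    have h2 : ∑ j, ∑ i, F' i j - ∑ j, ∑ i, scaleCols c F' i j
        ≤ (∑ j, |∑ i, F i j - c j|) / 2 := by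
      have hF2 : ∑ j, ∑ i, F i j = 1 := by rw [← hF.2]; exact Finset.sum_comm
      rw [← sum_max_eq_half (x := fun j => ∑ i, F i j - c j)
        (by rw [Finset.sum_sub_distrib, hF2, hc.2, sub_self]), ← Finset.sum_sub_distrib]
      refine Finset.sum_le_sum fun j _ => ?_
      rw [hcol]
      -- The columns of F' are lighter than those of F, so the excesses of F bound what column
      -- scaling removes.
      refine (sub_min_div_mul_le (hK j)).trans (max_le_max_right _ ?_)
      have := Finset.sum_le_sum fun i (_ : i ∈ Finset.univ) => hle' i j
      linarith
    have e1 : ∑ j, ∑ i, F' i j = ∑ i, ∑ j, F' i j := Finset.sum_comm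
    have e2 : ∑ j, ∑ i, scaleCols c F' i j = ∑ i, ∑ j, scaleCols c F' i j := Finset.sum_comm
    have := hF.2
    linarith

theorem frob_sub (A X Y : Matrix (Fin N) (Fin N) ℝ) : frob A (X - Y) = frob A X - frob A Y := by
  simp [frob, mul_sub, Finset.sum_sub_distrib]

theorem frob_le_frob (hC : ∀ i j, 0 ≤ C i j) {X Y : Matrix (Fin N) (Fin N) ℝ}
    (h : ∀ i j, X i j ≤ Y i j) : frob C X ≤ frob C Y :=
  Finset.sum_le_sum fun i _ => Finset.sum_le_sum fun j _ =>
    mul_le_mul_of_nonneg_left (h i j) (hC i j)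

/-- Row and column deficits are nonnegative and have the same total n, so the rank-one matrix with
these marginals is nonnegative of mass n and costs at most n‖C‖. -/
theorem correct_properties (hr : IsHistogram r) (hc : IsHistogram c)
    {G : Matrix (Fin N) (Fin N) ℝ} (hG : ∀ i j, 0 ≤ G i j) (hrow : ∀ i, ∑ j, G i j ≤ r i)
    (hcol : ∀ j, ∑ i, G i j ≤ c j) :
    correct r c G ∈ transportPolytope r c ∧
    frob C (correct r c G) ≤ frob C G + maxAbs C * (1 - ∑ i, ∑ j, G i j) := by
  have er : ∀ i, 0 ≤ r i - ∑ j, G i j := fun i => sub_nonneg.2 (hrow i)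
  have ec : ∀ j, 0 ≤ c j - ∑ i, G i j := fun j => sub_nonneg.2 (hcol j)
  have sr : ∑ i, (r i - ∑ j, G i j) = 1 - ∑ i, ∑ j, G i j := by
    rw [Finset.sum_sub_distrib, hr.2]
  have sc : ∑ j, (c j - ∑ i, G i j) = 1 - ∑ i, ∑ j, G i j := by
    rw [Finset.sum_sub_distrib, hc.2]
    congr 1
    exact Finset.sum_comm
  have sn : ∑ i, |r i - ∑ j, G i j| = 1 - ∑ i, ∑ j, G i j := by
    rw [← sr]
    exact Finset.sum_congr rfl fun i _ => abs_of_nonneg (er i)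
  have hn0 : 0 ≤ 1 - ∑ i, ∑ j, G i j := sr ▸ Finset.sum_nonneg fun i _ => er i
  rw [correct, sn]
  split_ifs with hn
  · have hz : 1 - ∑ i, ∑ j, G i j = 0 := le_antisymm hn hn0
    rw [hz] at sr sc ⊢
    have zr := (Finset.sum_eq_zero_iff_of_nonneg fun i _ => er i).1 sr
    have zc := (Finset.sum_eq_zero_iff_of_nonneg fun i _ => ec i).1 sc
    refine ⟨⟨hG, funext fun i => ?_, funext fun j => ?_⟩, by simp⟩
    · have := zr i (Finset.mem_univ i)
      simp only [Matrix.mulVec, dotProduct, Pi.one_apply, mul_one]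
      linarith
    · have := zc j (Finset.mem_univ j)
      simp only [Matrix.mulVec, dotProduct, Pi.one_apply, mul_one, Matrix.transpose_apply]
      linarith
  · push Not at hn
    set n := 1 - ∑ i, ∑ j, G i j with hndef
    refine ⟨⟨fun i j => ?_, funext fun i => ?_, funext fun j => ?_⟩, ?_⟩
    · exact add_nonneg (hG i j) (div_nonneg (mul_nonneg (er i) (ec j)) hn0)
    · simp only [Matrix.mulVec, dotProduct, Pi.one_apply, mul_one, Matrix.of_apply,
        Finset.sum_add_distrib]
      rw [← Finset.sum_div, ← Finset.mul_sum, sc, mul_div_cancel_right₀ _ hn.ne']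
      ring
    · simp only [Matrix.mulVec, dotProduct, Pi.one_apply, mul_one, Matrix.transpose_apply,
        Matrix.of_apply, Finset.sum_add_distrib]
      rw [← Finset.sum_div, ← Finset.sum_mul, sr, mul_div_cancel_left₀ _ hn.ne']
      ring
    · simp only [frob, Matrix.of_apply, mul_add, Finset.sum_add_distrib]
      refine add_le_add le_rfl ?_
      have e : maxAbs C * n = ∑ i, ∑ j, maxAbs C
          * ((r i - ∑ j, G i j) * (c j - ∑ i, G i j) / n) := by
        simp only [← Finset.mul_sum, ← Finset.sum_div]
        rw [sc, ← Finset.sum_mul, sr, mul_div_cancel_right₀ _ hn.ne']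
      rw [e]
      exact Finset.sum_le_sum fun i _ => Finset.sum_le_sum fun j _ =>
        mul_le_mul_of_nonneg_right (le_maxAbs C i j)
          (div_nonneg (mul_nonneg (er i) (ec j)) hn0)

theorem round_val (r c : Fin N → ℝ) (F : Matrix (Fin N) (Fin N) ℝ) :
    (Costed.round r c F).val = correct r c (scaleCols c (scaleRows r F)) := by
  have key : ∀ (n : ℝ) (X : Costed (Matrix (Fin N) (Fin N) ℝ))
      (Y : Costed (Matrix (Fin N) (Fin N) ℝ)),
      (if (Costed.le n 0).val = true then X else Y).val = if n ≤ 0 then X.val else Y.val := by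
    intro n X Y
    by_cases h : n ≤ 0 <;> simp [Costed.le, h]
  exact key _ _ _

theorem round_properties (hC : ∀ i j, 0 ≤ C i j) (hr : IsHistogram r) (hc : IsHistogram c)
    {F : Matrix (Fin N) (Fin N) ℝ} (hF : IsJoint F) :
    (Costed.round r c F).val ∈ transportPolytope r c ∧
    frob C (Costed.round r c F).val ≤ frob C F
      + maxAbs C * ((∑ i, |∑ j, F i j - r i| + ∑ j, |∑ i, F i j - c j|) / 2) := by
  obtain ⟨h1, h2, h3, h4, h5⟩ := scaled_properties hr hc hF
  obtain ⟨h6, h7⟩ := correct_properties (C := C) hr hc h1 h3 h4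
  rw [round_val]
  refine ⟨h6, h7.trans (add_le_add (frob_le_frob hC h2) ?_)⟩
  exact mul_le_mul_of_nonneg_left h5 (maxAbs_nonneg C)

end Rounding

/-! ### Accuracy of the returned matrix -/

section Accuracy

variable {N : ℕ} {C : Matrix (Fin N) (Fin N) ℝ} {r c : Fin N → ℝ} {γ ε : ℝ}

theorem regObj_le_frob (hγ : 0 ≤ γ) {X : Matrix (Fin N) (Fin N) ℝ} (hX : IsJoint X) :
    regObj C γ X ≤ frob C X := by
  have h : frob X (X.map Real.log) ≤ 0 :=
    Finset.sum_nonpos fun i _ => Finset.sum_nonpos fun j _ => by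
      refine mul_nonpos_of_nonneg_of_nonpos (hX.1 i j) (Real.log_nonpos (hX.1 i j) ?_)
      rw [← hX.2]
      exact (Finset.single_le_sum (fun j _ => hX.1 i j) (Finset.mem_univ j)).trans
        (Finset.single_le_sum (f := fun i => ∑ j, X i j)
          (fun i _ => Finset.sum_nonneg fun j _ => hX.1 i j) (Finset.mem_univ i))
  have := mul_nonneg hγ (neg_nonneg.2 h)
  rw [regObj]
  linarith

/-- ⟨X, ln X⟩ + 2 ln N is the relative entropy with respect to the uniform distribution on N²
points. -/
theorem frob_le_regObj [NeZero N] (hγ : 0 ≤ γ) {X : Matrix (Fin N) (Fin N) ℝ} (hX : IsJoint X) :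
    frob C X ≤ regObj C γ X + γ * (2 * Real.log N) := by
  have hN : (0 : ℝ) < N := by exact_mod_cast Nat.pos_of_ne_zero (NeZero.ne N)
  have h := pinsker_matrix (Y := Matrix.of fun _ _ => 1 / ((N : ℝ) * N)) hX
    ⟨fun i j => by simp only [Matrix.of_apply]; positivity, by
      simp only [Matrix.of_apply, Finset.sum_const, Finset.card_univ, Fintype.card_fin,
        nsmul_eq_mul]
      field_simp⟩
    (fun i j => by simp only [Matrix.of_apply]; positivity)
  have e : matEntropy X (Matrix.of fun _ _ => 1 / ((N : ℝ) * N))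
      = frob X (X.map Real.log) + 2 * Real.log N := by
    have e1 : Real.log (1 / ((N : ℝ) * N)) = -(2 * Real.log N) := by
      rw [one_div, Real.log_inv, Real.log_mul hN.ne' hN.ne']; ring
    rw [matEntropy, relEntropy, Fintype.sum_prod_type]
    simp only [Matrix.of_apply, e1, sub_neg_eq_add, mul_add, Finset.sum_add_distrib,
      ← Finset.sum_mul, hX.2, one_mul]
    rfl
  rw [e] at h
  have h2 := mul_nonneg hγ (le_trans (by positivity) h)
  rw [regObj]
  linarith

theorem sum_abs_le_of_admissible {M : ℝ} (hM : 0 < M) :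
    M * ((ε / (8 * M) / 4 + ε / (8 * M) / 4) / 2) = ε / 32 := by
  field_simp
  ring

/-- The errors add up to less than ε: ε/6 for rounding F, ε/2 for the entropy term, ε/6 for the gap,
and ε/32 for moving the competitor to the perturbed marginals. -/
theorem isApproxPlan_of_tests (hN : 2 ≤ N) (hC : ∀ i j, 0 ≤ C i j)
    (hr : IsHistogram r) (hε : 0 < ε) (hεM : ε ≤ maxAbs C)
    {m : (Fin N → ℝ) × (Fin N → ℝ)} (hm : IsAdmissible C r c ε m)
    {X F : Matrix (Fin N) (Fin N) ℝ} (hX : X ∈ transportPolytope r c) (hF : IsJoint F)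
    {η : Dual N} (h1 : frob C (X - F) ≤ ε / 6)
    (h2 : regObj C (ε / (4 * Real.log N)) F + dualObj C m.1 m.2 (ε / (4 * Real.log N)) η ≤ ε / 6) :
    IsApproxPlan C r c ε X := by
  have : NeZero N := ⟨by omega⟩
  have hlog : 0 < Real.log N := Real.log_pos (by exact_mod_cast hN)
  have hγ : 0 < ε / (4 * Real.log N) := by positivity
  refine ⟨hX, fun Y hY => ?_⟩
  obtain ⟨hm1, hm2, ha1, ha2, -, -⟩ := hm
  have hYj := isJoint_of_mem hr hY
  -- Weak duality needs a plan with the perturbed marginals, so the competitor Y is rounded to them;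
  -- this is used only for comparison.
  obtain ⟨hZ, hZle⟩ := round_properties hC hm1 hm2 hYj
  set Z := (Costed.round m.1 m.2 Y).val
  have hZj := isJoint_of_mem hm1 hZ
  have hw := weak_duality C m.1 m.2 hγ hZj η
  rw [marginals_of_mem hZ, sub_self, inner_zero_right] at hw
  have h3 := regObj_le_frob (C := C) hγ.le hZj
  have h4 := frob_le_regObj (C := C) hγ.le hF
  have e : ε / (4 * Real.log N) * (2 * Real.log N) = ε / 2 := by
    field_simp
    ring
  rw [e] at h4
  rw [frob_sub] at h1
  have hrow : ∀ i, ∑ j, Y i j = r i := fun i => by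
    rw [← hY.2.1]; simp [Matrix.mulVec, dotProduct]
  have hcol : ∀ j, ∑ i, Y i j = c j := fun j => by
    rw [← hY.2.2]; simp [Matrix.mulVec, dotProduct]
  have h5 : maxAbs C * ((∑ i, |∑ j, Y i j - m.1 i| + ∑ j, |∑ i, Y i j - m.2 j|) / 2)
      ≤ ε / 32 := by
    rw [← sum_abs_le_of_admissible (ε := ε) (hε.trans_le hεM)]
    refine mul_le_mul_of_nonneg_left ?_ (maxAbs_nonneg C)
    simp only [hrow, hcol, abs_sub_comm (r _), abs_sub_comm (c _)]
    linarith
  linarith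

theorem sum_abs_le_sqrt_mul_norm (p : Dual N) :
    ∑ i, |p (Sum.inl i)| + ∑ j, |p (Sum.inr j)| ≤ √(2 * N) * ‖p‖ := by
  rw [← Fintype.sum_sum_type (fun s => |p s|)]
  refine abs_le_of_sq_le_sq' ?_ (by positivity) |>.2
  rw [mul_pow, Real.sq_sqrt (by positivity), EuclideanSpace.norm_sq_eq]
  have h := sq_sum_le_card_mul_sum_sq (s := Finset.univ) (f := fun s => |p s|)
  rw [Finset.card_univ, Fintype.card_sum, Fintype.card_fin] at h
  refine h.trans (le_of_eq ?_)
  push_cast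
  simp only [Real.norm_eq_abs]
  ring

theorem frob_round_sub_le (hC : ∀ i j, 0 ≤ C i j) (hr : IsHistogram r) (hc : IsHistogram c)
    (hε : 0 < ε) (hεM : ε ≤ maxAbs C) {m : (Fin N → ℝ) × (Fin N → ℝ)}
    (hm : IsAdmissible C r c ε m) {F : Matrix (Fin N) (Fin N) ℝ} (hF : IsJoint F) :
    frob C ((Costed.round r c F).val - F)
      ≤ maxAbs C * (√(2 * N) * ‖marginals F - mkDual m.1 m.2‖) / 2 + ε / 32 := by
  obtain ⟨-, h⟩ := round_properties hC hr hc hF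
  obtain ⟨-, -, ha1, ha2, -, -⟩ := hm
  have h1 := sum_abs_le_sqrt_mul_norm (marginals F - mkDual m.1 m.2)
  simp only [PiLp.sub_apply, marginals_inl, marginals_inr, mkDual_inl, mkDual_inr] at h1
  have tri : ∀ p q s : Fin N → ℝ, ∑ i, |p i - s i| ≤ ∑ i, |p i - q i| + ∑ i, |q i - s i| := by
    intro p q s
    rw [← Finset.sum_add_distrib]
    exact Finset.sum_le_sum fun i _ => abs_sub_le _ _ _
  have h2 := tri (fun i => ∑ j, F i j) m.1 r
  have h3 := tri (fun j => ∑ i, F i j) m.2 c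
  rw [← sum_abs_le_of_admissible (ε := ε) (hε.trans_le hεM), frob_sub]
  have h4 : (∑ i, |∑ j, F i j - r i| + ∑ j, |∑ i, F i j - c j|) / 2
      ≤ (√(2 * N) * ‖marginals F - mkDual m.1 m.2‖) / 2
        + (ε / (8 * maxAbs C) / 4 + ε / (8 * maxAbs C) / 4) / 2 := by
    linarith
  have h5 := mul_le_mul_of_nonneg_left h4 (maxAbs_nonneg C)
  rw [mul_add] at h5
  linarith

theorem rho_le (hN : 2 ≤ N) (hε : 0 < ε) (hεM : ε ≤ maxAbs C)
    {m : (Fin N → ℝ) × (Fin N → ℝ)} (hm : IsAdmissible C r c ε m) :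
    maxAbs C - ε / (4 * Real.log N) / 2 * Real.log (minEntry m.1 m.2) ≤ 3 * maxAbs C := by
  have : NeZero N := ⟨by omega⟩
  have hN2 : (2 : ℝ) ≤ N := by exact_mod_cast hN
  have hM : 0 < maxAbs C := hε.trans_le hεM
  have hlog2 := Real.log_two_gt_d9
  have hlogN : Real.log 2 ≤ Real.log N := Real.log_le_log (by norm_num) hN2
  have hlog : 0 < Real.log N := by linarith
  obtain ⟨-, -, -, -, h1, h2⟩ := hm
  have h3 := le_minEntry h1 h2
  have e1 : ε / (8 * maxAbs C) / (8 * N) = ((2 : ℝ) ^ 6 * N * (maxAbs C / ε))⁻¹ := by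
    field_simp
    norm_num
  have h4 := Real.log_le_log (by rw [e1]; positivity) h3
  rw [e1, Real.log_inv, Real.log_mul (by positivity) (by positivity),
    Real.log_mul (by positivity) (by positivity), Real.log_pow] at h4
  have h5 := Real.log_le_sub_one_of_pos (div_pos hM hε)
  -- The minimum is at least ε/(64 N‖C‖): here ln 64 = 6 ln 2 ≤ 6 ln N and ln x ≤ x. After
  -- multiplication by ε/(8 ln N) no logarithm of ‖C‖/ε survives.
  have h6 : -Real.log (minEntry m.1 m.2) ≤ 7 * Real.log N + maxAbs C / ε := by
    push_cast at h4
    linarith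
  have h7 := mul_le_mul_of_nonneg_left h6
    (by positivity : 0 ≤ ε / (4 * Real.log N) / 2)
  have e2 : ε / (4 * Real.log N) / 2 * (7 * Real.log N + maxAbs C / ε)
      = 7 / 8 * ε + maxAbs C * (1 / (8 * Real.log N)) := by
    field_simp
    norm_num
  have h8 : 1 / (8 * Real.log N) ≤ 1 / 4 := by
    rw [div_le_div_iff₀ (by positivity) (by norm_num)]
    linarith
  have h9 := mul_le_mul_of_nonneg_left h8 hM.le
  rw [e2] at h7
  linarith

theorem test_of_iterations (hN : 2 ≤ N) (hC : ∀ i j, 0 ≤ C i j) (hr : IsHistogram r)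
    (hc : IsHistogram c) (hε : 0 < ε) (hεM : ε ≤ maxAbs C) {m : (Fin N → ℝ) × (Fin N → ℝ)}
    (hm : IsAdmissible C r c ε m) {F : Matrix (Fin N) (Fin N) ℝ} (hF : IsJoint F) {k : ℕ}
    (hk0 : 1 ≤ k) (hk : 56 * (√N * √(Real.log N) * maxAbs C / ε) ≤ k)
    (h : ‖marginals F - mkDual m.1 m.2‖ ≤ 64 * √((N : ℝ) / 2)
      * (maxAbs C - ε / (4 * Real.log N) / 2 * Real.log (minEntry m.1 m.2))
        / (ε / (4 * Real.log N) * (k : ℝ) ^ 2)) :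
    frob C ((Costed.round r c F).val - F) ≤ ε / 6 := by
  have hM : 0 < maxAbs C := hε.trans_le hεM
  have hN1 : (1 : ℝ) < N := by exact_mod_cast hN
  have hlog : 0 < Real.log N := Real.log_pos hN1
  have hk1 : (0 : ℝ) < k := by exact_mod_cast hk0
  have h1 := frob_round_sub_le hC hr hc hε hεM hm hF
  have h2 : ‖marginals F - mkDual m.1 m.2‖ ≤ 64 * √((N : ℝ) / 2) * (3 * maxAbs C)
      / (ε / (4 * Real.log N) * (k : ℝ) ^ 2) := by
    refine h.trans ?_
    gcongr
    exact rho_le hN hε hεM hm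
  have h3 : √(2 * N) * √((N : ℝ) / 2) = N := by
    rw [← Real.sqrt_mul (by positivity), show (2 * N * (N / 2) : ℝ) = N ^ 2 by ring,
      Real.sqrt_sq (by positivity)]
  have h4 : maxAbs C * (√(2 * N) * ‖marginals F - mkDual m.1 m.2‖) / 2
      ≤ 384 * N * Real.log N * maxAbs C ^ 2 / (ε * k ^ 2) := by
    calc maxAbs C * (√(2 * N) * ‖marginals F - mkDual m.1 m.2‖) / 2
        ≤ maxAbs C * (√(2 * N) * (64 * √((N : ℝ) / 2) * (3 * maxAbs C)
          / (ε / (4 * Real.log N) * (k : ℝ) ^ 2))) / 2 := by gcongr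
      _ = maxAbs C * ((√(2 * N) * √((N : ℝ) / 2)) * (64 * (3 * maxAbs C)
          / (ε / (4 * Real.log N) * (k : ℝ) ^ 2))) / 2 := by ring
      _ = _ := by
        rw [h3]
        field_simp
        ring
  -- 3136 = 56² exceeds 8 · 384, so the residual costs at most ε/8, and 1/8 + 1/32 < 1/6.
  have h5 : 3136 * (N * Real.log N * maxAbs C ^ 2) ≤ ε ^ 2 * k ^ 2 := by
    have h6 := pow_le_pow_left₀ (by positivity) hk 2
    rw [mul_pow, div_pow, mul_pow, mul_pow, Real.sq_sqrt (by positivity),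
      Real.sq_sqrt hlog.le] at h6
    have h7 := mul_le_mul_of_nonneg_left h6 (sq_nonneg ε)
    refine le_trans (le_of_eq ?_) h7
    field_simp
    norm_num
  have h6 : 384 * N * Real.log N * maxAbs C ^ 2 / (ε * k ^ 2) ≤ ε / 8 := by
    rw [div_le_iff₀ (by positivity)]
    have h7 : 0 ≤ N * Real.log N * maxAbs C ^ 2 := by positivity
    nlinarith
  linarith

end Accuracy

/-! ### Values and costs of the implementation -/

namespace Costed

theorem val_bind {α β : Type} (x : Costed α) (f : α → Costed β) :
    (x >>= f).val = (f x.val).val := rfl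

theorem ops_bind {α β : Type} (x : Costed α) (f : α → Costed β) :
    (x >>= f).ops = x.ops + (f x.val).ops := rfl

theorem val_pure {α : Type} (x : α) : (pure x : Costed α).val = x := rfl

theorem ops_pure {α : Type} (x : α) : (pure x : Costed α).ops = 0 := rfl

variable {N : ℕ} (C : Matrix (Fin N) (Fin N) ℝ) (r c : Fin N → ℝ) (γ : ℝ)

theorem nextA_val (s : State N) (L' : ℝ) : (nextA s L').val = s.nextA L' := by
  change 1 / (2 * L') + √(1 / (4 * (L' * L')) + s.a * s.a * (s.L / L')) = _
  rw [State.nextA, sq, sq]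

theorem combine_val (x y : ℝ) (p q : Dual N) : (combine x y p q).val = x • p + y • q := by
  ext (i | j) <;> rfl

theorem lam_val (s : State N) (L' : ℝ) : (lam s L' (s.nextA L')).val = s.lam L' := by
  change (combine (1 / (s.nextA L' * L')) (1 - 1 / (s.nextA L' * L')) s.ζ s.η).val = _
  rw [combine_val]
  rfl

theorem dualObj_val (p : Dual N) : (dualObj C r c γ p).val = AccSinkhorn.dualObj C r c γ p := rfl

theorem grad_val (p : Dual N) : (grad C r c γ p).val = dualGrad C r c γ p := by
  ext (i | j)
  · rw [dualGrad_inl, mass_eq_rowSums]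
    simp only [Matrix.mulVec, dotProduct, Pi.one_apply, mul_one]
    rfl
  · rw [dualGrad_inr, mass_eq_rowSums]
    simp only [Matrix.mulVec, dotProduct, Pi.one_apply, mul_one]
    rfl

theorem blockSq_val (g : Dual N) (b : Block) : (blockSq g b).val = AccSinkhorn.blockSq g b := by
  cases b
  · change ∑ i, g (Sum.inl i) * g (Sum.inl i) = ∑ i, g (Sum.inl i) ^ 2
    simp only [sq]
  · change ∑ i, g (Sum.inr i) * g (Sum.inr i) = ∑ i, g (Sum.inr i) ^ 2
    simp only [sq]

theorem blockUpdate_val (p : Dual N) (b : Block) :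
    (blockUpdate C r c γ p b).val = AccSinkhorn.blockUpdate C r c γ p b := by
  cases b
  · ext (i | j)
    · simp only [AccSinkhorn.blockUpdate, Matrix.mulVec, dotProduct, Pi.one_apply, mul_one]
      rfl
    · rfl
  · ext (i | j)
    · rfl
    · simp only [AccSinkhorn.blockUpdate, Matrix.mulVec, dotProduct, Pi.one_apply, mul_one]
      rfl

theorem average_val (s : State N) (L' : ℝ) (p : Dual N) :
    (average C γ s L' (s.nextA L') p).val = (1 / (L' * s.nextA L' ^ 2)) •
      (s.nextA L' • primalPoint C γ p + (s.L * s.a ^ 2) • s.xhat) := by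
  ext i j
  change (s.nextA L' * (AccSinkhorn.kernelB C γ p i j / mass C γ p)
    + s.L * (s.a * s.a) * s.xhat i j) / (L' * (s.nextA L' * s.nextA L')) = _
  simp only [Matrix.smul_apply, Matrix.add_apply, smul_eq_mul, primalPoint_apply]
  rw [div_eq_inv_mul (AccSinkhorn.kernelB C γ p i j), div_eq_inv_mul, one_div, sq, sq]

-- Links the implementation to the abstract iteration: the tie-breaking rule selects some greedy
-- block, and the test uses blockwise norms whose sum is ‖∇φ‖².
open Classical in
theorem trial_spec [NeZero N] (s : State N) (L' : ℝ) :
    ∃ b, IsGreedyBlock C r c γ (s.lam L') b ∧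
      (trial C r c γ s L').val = (s.next C r c γ L' b, decide (s.Accepts C r c γ L' b)) := by
  set g := dualGrad C r c γ (s.lam L') with hg
  set b : Block := bif (le (AccSinkhorn.blockSq g .v) (AccSinkhorn.blockSq g .u)).val
    then .u else .v with hb
  refine ⟨b, ?_, ?_⟩
  · intro b'
    rw [gradient_dualObj, ← hg, hb]
    by_cases h : AccSinkhorn.blockSq g .v ≤ AccSinkhorn.blockSq g .u
    · cases b' <;> simp [le, h]
    · cases b' <;> simp [le, h, (not_le.1 h).le]
  · have e : (trial C r c γ s L').val = ((⟨L', s.nextA L', s.ζ - s.nextA L' • g,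
        AccSinkhorn.blockUpdate C r c γ (s.lam L') b, (s.next C r c γ L' b).xhat⟩ : State N),
        (le (AccSinkhorn.dualObj C r c γ (AccSinkhorn.blockUpdate C r c γ (s.lam L') b))
          (AccSinkhorn.dualObj C r c γ (s.lam L')
            - (AccSinkhorn.blockSq g .u + AccSinkhorn.blockSq g .v) / (2 * L'))).val) := by
      simp only [trial, val_bind, val_pure, nextA_val, lam_val, grad_val, blockSq_val,
        blockUpdate_val, dualObj_val, average_val, combine_val]
      rw [← hg, ← hb]
      have hz : (1 : ℝ) • s.ζ + (sub 0 (s.nextA L')).val • g = s.ζ - s.nextA L' • g := by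
        change (1 : ℝ) • s.ζ + (0 - s.nextA L') • g = _
        module
      rw [hz]
      rfl
    rw [e, ← normSq_dual]
    simp only [State.next, State.Accepts, gradient_dualObj, ← hg, le]

/-! #### Numbers of operations -/

theorem ops_add (x y : ℝ) : (add x y).ops = 1 := rfl
theorem ops_sub (x y : ℝ) : (sub x y).ops = 1 := rfl
theorem ops_mul (x y : ℝ) : (mul x y).ops = 1 := rfl
theorem ops_div (x y : ℝ) : (div x y).ops = 1 := rfl
theorem ops_log (x : ℝ) : (log x).ops = 1 := rfl
theorem ops_le (x y : ℝ) : (le x y).ops = 1 := rfl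
theorem ops_sum (x : Fin N → ℝ) : (sum x).ops = N := rfl

theorem ops_vec {f : Fin N → Costed ℝ} {k : ℕ} (h : ∀ i, (f i).ops = k) :
    (vec f).ops = N * k := by
  simp [vec, h]

theorem ops_mat {f : Fin N → Fin N → Costed ℝ} {k : ℕ} (h : ∀ i j, (f i j).ops = k) :
    (mat f).ops = N * (N * k) := by
  simp [mat, h]

theorem ops_dot (x y : Fin N → ℝ) : (dot x y).ops = N * 1 + N := by
  rw [dot, ops_bind, ops_vec fun _ => ops_mul _ _, ops_sum]

theorem ops_rowSums (X : Matrix (Fin N) (Fin N) ℝ) : (rowSums X).ops = N * N :=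
  ops_vec fun _ => ops_sum _

theorem ops_colSums (X : Matrix (Fin N) (Fin N) ℝ) : (colSums X).ops = N * N :=
  ops_vec fun _ => ops_sum _

theorem ops_frob (A B : Matrix (Fin N) (Fin N) ℝ) :
    (frob A B).ops = N * (N * 1) + (N * N + N) := by
  rw [frob, ops_bind, ops_mat (k := 1) fun _ _ => rfl, ops_bind, ops_rowSums, ops_sum]

theorem ops_kernelB (p : Dual N) : (kernelB C γ p).ops = N * (N * 4) :=
  ops_mat fun _ _ => rfl

theorem ops_dualObj (p : Dual N) : (dualObj C r c γ p).ops = 5 * (N * N) + 5 * N + 4 := by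
  simp only [dualObj, ops_bind, ops_kernelB, ops_rowSums, ops_sum, ops_dot, ops_log, ops_sub,
    ops_mul]
  ring

theorem ops_regObj (X : Matrix (Fin N) (Fin N) ℝ) :
    (regObj C γ X).ops = 5 * (N * N) + 2 * N + 2 := by
  simp only [regObj, ops_bind, ops_frob, ops_mul, ops_add]
  rw [ops_mat (k := 1) fun _ _ => rfl]
  ring

theorem ops_combine (x y : ℝ) (p q : Dual N) : (combine x y p q).ops = 6 * N := by
  rw [combine, ops_bind, ops_vec (k := 3) fun _ => rfl, ops_bind, ops_vec (k := 3) fun _ => rfl,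
    ops_pure]
  ring

theorem ops_lam (s : State N) (L' a' : ℝ) : (lam s L' a').ops = 6 * N + 3 := by
  simp only [lam, ops_bind, ops_combine, ops_mul, ops_div, ops_sub]
  ring

theorem ops_grad (p : Dual N) : (grad C r c γ p).ops = 6 * (N * N) + 7 * N := by
  simp only [grad, ops_bind, ops_kernelB, ops_rowSums, ops_colSums, ops_sum, ops_pure]
  rw [ops_vec (k := 3) fun _ => rfl, ops_vec (k := 3) fun _ => rfl]
  ring

theorem ops_blockSq (g : Dual N) (b : Block) : (blockSq g b).ops = 2 * N := by
  cases b <;> simp only [blockSq, ops_dot] <;> ring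

theorem ops_blockUpdate (p : Dual N) (b : Block) :
    (blockUpdate C r c γ p b).ops = 5 * (N * N) + 4 * N := by
  cases b <;>
  · simp only [blockUpdate, ops_bind, ops_kernelB, ops_rowSums, ops_colSums, ops_pure]
    rw [ops_vec (k := 4) fun _ => rfl]
    ring

theorem ops_average (s : State N) (L' a' : ℝ) (p : Dual N) :
    (average C γ s L' a' p).ops = 10 * (N * N) + N + 4 := by
  simp only [average, ops_bind, ops_kernelB, ops_rowSums, ops_sum, ops_mul]
  rw [ops_mat (k := 5) fun _ _ => rfl]
  ring

theorem ops_trial (s : State N) (L' : ℝ) :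
    (trial C r c γ s L').ops = 31 * (N * N) + 38 * N + 33 := by
  have h : (nextA s L').ops = 11 := rfl
  simp only [trial, ops_bind, h, ops_lam, ops_grad, ops_blockSq, ops_le, ops_blockUpdate, ops_sub,
    ops_combine, ops_dualObj, ops_add, ops_mul, ops_div, ops_average, ops_pure]
  ring

theorem ops_round (F : Matrix (Fin N) (Fin N) ℝ) :
    (round r c F).ops ≤ 9 * (N * N) + 8 * N + 1 := by
  have h : ∀ i j : Fin N → ℝ, ∀ n : ℝ, ∀ G : Matrix (Fin N) (Fin N) ℝ,
      (if (le n 0).val = true then pure G else mat fun a b => do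
        let t ← mul (i a) (j b)
        let q ← div t n
        add (G a b) q : Costed (Matrix (Fin N) (Fin N) ℝ)).ops ≤ N * (N * 3) := by
    intro i j n G
    split_ifs
    · exact Nat.zero_le _
    · exact (ops_mat (k := 3) fun _ _ => rfl).le
  simp only [round, ops_bind, ops_rowSums, ops_colSums, ops_sum, ops_le]
  rw [ops_vec (k := 2) fun _ => rfl, ops_mat (k := 1) fun _ _ => rfl, ops_vec (k := 2) fun _ => rfl,
    ops_mat (k := 1) fun _ _ => rfl, ops_vec (k := 1) fun _ => rfl, ops_vec (k := 1) fun _ => rfl,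
    ops_vec (k := 1) fun _ => rfl]
  grw [h]
  ring_nf
  omega

theorem ops_perturb (ε : ℝ) : (perturb C r c ε).ops = 2 * (N * N) + 4 * N + 7 := by
  have h : (maxAbs C).ops = N * N + N * N := rfl
  simp only [perturb, ops_bind, h, ops_mul, ops_div, ops_sub, ops_pure]
  rw [ops_vec (k := 2) fun _ => rfl, ops_vec (k := 2) fun _ => rfl]
  ring

/-! ### One pass of the main loop -/

section MainLoop

variable {N : ℕ} {C : Matrix (Fin N) (Fin N) ℝ} {r c : Fin N → ℝ} {ε γ : ℝ} {r' c' : Fin N → ℝ}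

theorem mainStep_val_of_rejected {z : Config N}
    (h : (trial C r' c' γ z.state z.cand).val.2 = false) :
    (mainStep C r c ε γ r' c' z).val = Sum.inl ⟨z.state, 2 * z.cand⟩ := by
  simp only [mainStep, val_bind, h]
  rfl

theorem mainStep_val_of_accepted {z : Config N} {s' : State N}
    (h : (trial C r' c' γ z.state z.cand).val = (s', true)) :
    (mainStep C r c ε γ r' c' z).val =
      if AccSinkhorn.frob C ((round r c s'.xhat).val - s'.xhat) ≤ ε / 6 ∧
        AccSinkhorn.regObj C γ s'.xhat + AccSinkhorn.dualObj C r' c' γ s'.η ≤ ε / 6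
      then Sum.inr (round r c s'.xhat).val else Sum.inl ⟨s', s'.L / 2⟩ := by
  have e : (mainStep C r c ε γ r' c' z).val =
      (if ((le (AccSinkhorn.frob C ((round r c s'.xhat).val - s'.xhat)) (ε / 6)).val &&
        (le (AccSinkhorn.regObj C γ s'.xhat + AccSinkhorn.dualObj C r' c' γ s'.η) (ε / 6)).val)
          = true
      then pure (Sum.inr (round r c s'.xhat).val)
      else (do
        let L' ← div s'.L 2
        pure (Sum.inl ⟨s', L'⟩)) :
        Costed (Config N ⊕ Matrix (Fin N) (Fin N) ℝ)).val := by
    simp only [mainStep, val_bind, h, if_true]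
    rfl
  rw [e]
  simp only [le, Bool.and_eq_true, decide_eq_true_eq]
  split_ifs <;> rfl

theorem ops_mainStep (z : Config N) :
    (mainStep C r c ε γ r' c' z).ops ≤ 53 * (N * N) + 54 * N + 50 := by
  have hr := ops_round r c (trial C r' c' γ z.state z.cand).val.1.xhat
  simp only [mainStep, ops_bind, ops_trial]
  split_ifs
  · simp only [ops_bind, ops_frob, ops_regObj, ops_dualObj, ops_add, ops_div, ops_le]
    rw [ops_mat (k := 1) fun _ _ => rfl]
    split_ifs
    · simp only [ops_pure]
      linarith
    · simp only [ops_bind, ops_div, ops_pure]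
      linarith
  · simp only [ops_bind, ops_mul, ops_pure]
    nlinarith

end MainLoop

/-- A loop whose invariant bounds the number `n` of completed passes by `B` returns. -/
theorem exists_loopReturns {σ β : Type} {step : σ → Costed (σ ⊕ β)} {Inv : σ → ℕ → Prop}
    {Q : β → Prop} {M B : ℕ} (hB : ∀ s n, Inv s n → n ≤ B) (hM : ∀ s, (step s).ops ≤ M)
    (hstep : ∀ s n, Inv s n → (∃ b, (step s).val = Sum.inr b ∧ Q b) ∨
      ∃ s', (step s).val = Sum.inl s' ∧ Inv s' (n + 1)) (s : σ) (n : ℕ) (hs : Inv s n) :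
    ∃ b t, LoopReturns step s b t ∧ Q b ∧ t ≤ M * (B + 1 - n) := by
  -- Induction on the number of passes left: at d = 0 a further pass would break the bound B.
  obtain ⟨d, hd⟩ : ∃ d, B = n + d := ⟨B - n, by have := hB s n hs; omega⟩
  induction d generalizing s n with
  | zero =>
    rcases hstep s n hs with ⟨b, hb, hQ⟩ | ⟨s', _, hi⟩
    · refine ⟨b, _, LoopReturns.done s b hb, hQ, (hM s).trans ?_⟩
      exact Nat.le_mul_of_pos_right _ (by omega)
    · have := hB s' (n + 1) hi
      omega
  | succ d ih =>
    rcases hstep s n hs with ⟨b, hb, hQ⟩ | ⟨s', hs', hi⟩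
    · refine ⟨b, _, LoopReturns.done s b hb, hQ, (hM s).trans ?_⟩
      exact Nat.le_mul_of_pos_right _ (by omega)
    · obtain ⟨b, t, hl, hQ, ht⟩ := ih s' (n + 1) hi (by omega)
      refine ⟨b, _, LoopReturns.next s s' b t hs' hl, hQ, ?_⟩
      have e : B + 1 - n = (B + 1 - (n + 1)) + 1 := by omega
      rw [e, mul_add, mul_one, add_comm]
      exact Nat.add_le_add ht (hM s)

end Costed

/-! ### Complexity -/

section Complexity

variable {N : ℕ} {C : Matrix (Fin N) (Fin N) ℝ} {r c : Fin N → ℝ} {ε : ℝ}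

theorem isAdmissible_perturb (hN : 2 ≤ N) (hr : IsHistogram r) (hc : IsHistogram c) (hε : 0 < ε)
    (hεM : ε ≤ maxAbs C) : IsAdmissible C r c ε (Costed.perturb C r c ε).val := by
  have hM : 0 < maxAbs C := hε.trans_le hεM
  have hN0 : (0 : ℝ) < N := by exact_mod_cast (by omega : 0 < N)
  set ε' := ε / (8 * maxAbs C) with hε'
  have h0 : 0 < ε' := by positivity
  have h1 : ε' ≤ 1 / 8 := by
    rw [hε', div_le_div_iff₀ (by positivity) (by norm_num)]
    linarith
  have h8 : 8 - ε' ≠ 0 := by linarith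
  have e : (Costed.perturb C r c ε).val
      = (fun i => (1 - ε' / 8) * r i + ε' / (8 * N),
          fun j => (1 - ε' / 8) * c j + ε' / (8 * N)) := by
    have key : ∀ x : ℝ, (1 - ε' / 8) * (x + ε' / (N * (8 - ε')))
        = (1 - ε' / 8) * x + ε' / (8 * N) := fun x => by
      field_simp
    exact Prod.ext (funext fun i => key (r i)) (funext fun j => key (c j))
  have hist : ∀ s : Fin N → ℝ, IsHistogram s →
      IsHistogram (fun i => (1 - ε' / 8) * s i + ε' / (8 * N)) := fun s hs => by
    refine ⟨fun i => ?_, ?_⟩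
    · have := mul_nonneg (by linarith : 0 ≤ 1 - ε' / 8) (hs.1 i)
      positivity
    · rw [Finset.sum_add_distrib, ← Finset.mul_sum, hs.2, Finset.sum_const, Finset.card_univ,
        Fintype.card_fin, nsmul_eq_mul]
      field_simp
      ring
  have dist : ∀ s : Fin N → ℝ, IsHistogram s →
      ∑ i, |(1 - ε' / 8) * s i + ε' / (8 * N) - s i| ≤ ε' / 4 := fun s hs => by
    calc ∑ i, |(1 - ε' / 8) * s i + ε' / (8 * N) - s i|
        ≤ ∑ i, (ε' / 8 * s i + ε' / (8 * N)) := Finset.sum_le_sum fun i _ => by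
          have h2 := mul_nonneg h0.le (hs.1 i)
          have h3 : 0 < ε' / (8 * N) := by positivity
          rw [abs_le]
          constructor <;> linarith
      _ = ε' / 4 := by
        rw [Finset.sum_add_distrib, ← Finset.mul_sum, hs.2, Finset.sum_const, Finset.card_univ,
          Fintype.card_fin, nsmul_eq_mul]
        field_simp
        ring
  have low : ∀ s : Fin N → ℝ, IsHistogram s → ∀ i,
      ε' / (8 * N) ≤ (1 - ε' / 8) * s i + ε' / (8 * N) := fun s hs i => by
    have := mul_nonneg (by linarith : 0 ≤ 1 - ε' / 8) (hs.1 i)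
    linarith
  rw [e]
  exact ⟨hist r hr, hist c hc, dist r hr, dist c hc, low r hr, low c hc⟩

theorem IsAdmissible.pos (hN : 2 ≤ N) (hε : 0 < ε) (hεM : ε ≤ maxAbs C)
    {m : (Fin N → ℝ) × (Fin N → ℝ)} (hm : IsAdmissible C r c ε m) :
    (∀ i, 0 < m.1 i) ∧ ∀ j, 0 < m.2 j := by
  have hM : 0 < maxAbs C := hε.trans_le hεM
  have hN0 : (0 : ℝ) < N := by exact_mod_cast (by omega : 0 < N)
  have h : 0 < ε / (8 * maxAbs C) / (8 * N) := by positivity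
  exact ⟨fun i => h.trans_le (hm.2.2.2.2.1 i), fun j => h.trans_le (hm.2.2.2.2.2 j)⟩

/-- The invariant of the main loop after `acc` accepted and `rej` rejected candidates, where at
most `K` iterations are completed. -/
structure LoopInvariant (C : Matrix (Fin N) (Fin N) ℝ) (r' c' : Fin N → ℝ) (γ L₀ : ℝ) (K : ℕ)
    (z : Costed.Config N) (acc rej : ℕ) : Prop where
  good : z.state.Good C r' c' γ acc
  cand_pos : 0 < z.cand
  cand_le : z.cand ≤ max (z.state.L / 2) (2 * γ)
  cand_eq : z.cand * 2 ^ acc = L₀ / 2 * 2 ^ rej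
  acc_lt : acc < K

theorem lipBound_le (k : ℕ) : lipBound k ≤ 16 := by
  rcases k with _ | _ | _ | k
  iterate 3 norm_num [lipBound]
  change (2 : ℝ) ≤ 16
  norm_num

/-- The candidate is always (L₀/2) · 2^(rej − acc) and at most 8γ, while L₀ ≥ θγ; so 2^(rej − acc) ≤
16/θ. -/
theorem LoopInvariant.rej_le {r' c' : Fin N → ℝ} {γ L₀ θ : ℝ} {K : ℕ} {z : Costed.Config N}
    {acc rej : ℕ} (h : LoopInvariant C r' c' γ L₀ K z acc rej) (hγ : 0 < γ) (hθ : 0 < θ)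
    (hL : θ * γ ≤ L₀) {q : ℕ} (hq : 16 / θ < 2 ^ q) : rej < acc + q := by
  have h1 : z.cand ≤ 8 * γ := by
    refine h.cand_le.trans (max_le ?_ (by linarith))
    have := h.good.2.L_le.trans (mul_le_mul_of_nonneg_right (lipBound_le acc) hγ.le)
    linarith
  have h2 : θ * γ / 2 * 2 ^ rej ≤ 8 * γ * 2 ^ acc := by
    calc θ * γ / 2 * 2 ^ rej ≤ L₀ / 2 * 2 ^ rej := by gcongr
      _ = z.cand * 2 ^ acc := h.cand_eq.symm
      _ ≤ _ := by gcongr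
  rw [div_lt_iff₀ hθ] at hq
  have h3 : (2 : ℝ) ^ rej < 2 ^ (acc + q) := by
    have h4 : (0 : ℝ) < 2 ^ acc := by positivity
    have h5 : θ * 2 ^ rej ≤ 16 * 2 ^ acc := by
      refine le_of_mul_le_mul_left ?_ hγ
      linarith
    have h6 := mul_lt_mul_of_pos_right hq h4
    rw [pow_add]
    refine lt_of_mul_lt_mul_left ?_ hθ.le
    linarith
  exact (pow_lt_pow_iff_right₀ (one_lt_two (α := ℝ))).1 h3

theorem mainStep_spec (hN : 2 ≤ N) (hC : ∀ i j, 0 ≤ C i j) (hr : IsHistogram r)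
    (hc : IsHistogram c) (hε : 0 < ε) (hεM : ε ≤ maxAbs C) {m : (Fin N → ℝ) × (Fin N → ℝ)}
    (hm : IsAdmissible C r c ε m) {L₀ : ℝ} {K : ℕ}
    (hK : 56 * (√N * √(Real.log N) * maxAbs C / ε) ≤ K) {z : Costed.Config N} {acc rej : ℕ}
    (hz : LoopInvariant C m.1 m.2 (ε / (4 * Real.log N)) L₀ K z acc rej) :
    (∃ X, (Costed.mainStep C r c ε (ε / (4 * Real.log N)) m.1 m.2 z).val = Sum.inr X ∧
      IsApproxPlan C r c ε X) ∨
    ∃ z', (Costed.mainStep C r c ε (ε / (4 * Real.log N)) m.1 m.2 z).val = Sum.inl z' ∧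
      (LoopInvariant C m.1 m.2 (ε / (4 * Real.log N)) L₀ K z' (acc + 1) rej ∨
        LoopInvariant C m.1 m.2 (ε / (4 * Real.log N)) L₀ K z' acc (rej + 1)) := by
  classical
  have : NeZero N := ⟨by omega⟩
  have hlog : 0 < Real.log N := Real.log_pos (by exact_mod_cast hN)
  set γ := ε / (4 * Real.log N) with hγdef
  have hγ : 0 < γ := by positivity
  obtain ⟨hm1, hm2⟩ := hm.pos hN hε hεM
  obtain ⟨b, hb, hval⟩ := Costed.trial_spec C m.1 m.2 γ z.state z.cand
  by_cases hacc : z.state.Accepts C m.1 m.2 γ z.cand b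
  · rw [decide_eq_true hacc] at hval
    have hgood : (z.state.next C m.1 m.2 γ z.cand b).Good C m.1 m.2 γ (acc + 1) :=
      ⟨hz.good.1.next hγ hz.cand_pos hacc,
        hz.good.2.next hγ hz.good.1 hz.cand_pos hz.cand_le b⟩
    rw [Costed.mainStep_val_of_accepted hval]
    set s' := z.state.next C m.1 m.2 γ z.cand b with hs'
    have hA := hgood.2.A_pos (Nat.le_add_left 1 acc) hγ
    have hF := hgood.1.isJoint hA
    by_cases htest : frob C ((Costed.round r c s'.xhat).val - s'.xhat) ≤ ε / 6 ∧
        regObj C γ s'.xhat + dualObj C m.1 m.2 γ s'.η ≤ ε / 6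
    · left
      rw [if_pos htest]
      exact ⟨_, rfl, isApproxPlan_of_tests hN hC hr hε hεM hm (round_properties hC hr hc hF).1 hF
        htest.1 htest.2⟩
    · right
      rw [if_neg htest]
      refine ⟨_, rfl, Or.inl ⟨hgood, half_pos hgood.1.L_pos, le_max_left _ _, ?_, ?_⟩⟩
      · have h1 : s'.L = z.cand := rfl
        change s'.L / 2 * 2 ^ (acc + 1) = _
        rw [h1, ← hz.cand_eq, pow_succ]
        ring
      -- If this were the K-th iteration, both tests would have passed: the first by the residual
      -- rate, the second because the gap is never positive.
      · by_contra hlt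
        have hKe : acc + 1 = K := by
          have := hz.acc_lt
          omega
        refine htest ⟨?_, ?_⟩
        · obtain ⟨y, hy, hyn⟩ := exists_dual_solution hγ hC hm.1 hm.2.1 hm1 hm2
          have hrate := (hgood.rates hγ hm.1 hm.2.1 hm1 hm2 (Nat.le_add_left 1 acc) hy hyn).1
          rw [hKe] at hrate
          exact test_of_iterations hN hC hr hc hε hεM hm hF (by omega) hK hrate
        · have h2 := hgood.1.gap_le' hA
          have h3 : 0 ≤ s'.A * γ ^ 2 * ‖marginals s'.xhat - mkDual m.1 m.2‖ ^ 2 / 2 := by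
            positivity
          linarith
  · right
    rw [decide_eq_false hacc] at hval
    rw [Costed.mainStep_val_of_rejected (by rw [hval])]
    have hlt : z.cand < γ := by
      by_contra! h
      exact hacc (accepts_of_le C hγ hm.1 hm.2.1 hm1 hm2 z.state h hb)
    have hpos := hz.cand_pos
    refine ⟨_, rfl, Or.inr ⟨hz.good, ?_, ?_, ?_, hz.acc_lt⟩⟩
    · change 0 < 2 * z.cand
      linarith
    · change 2 * z.cand ≤ _
      exact le_max_of_le_right (by linarith)
    · change 2 * z.cand * 2 ^ acc = _
      rw [mul_assoc, hz.cand_eq, pow_succ]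
      ring

theorem solvesWithin (hN : 2 ≤ N) (hC : ∀ i j, 0 ≤ C i j) (hr : IsHistogram r)
    (hc : IsHistogram c) (hε : 0 < ε) (hεM : ε ≤ maxAbs C) {θ : ℝ} (hθ : 0 < θ) {q : ℕ}
    (hq : 16 / θ < 2 ^ q) {L₀ : ℝ} (hL : θ * (ε / (4 * Real.log N)) ≤ L₀)
    (hL' : L₀ ≤ 16 * (ε / (4 * Real.log N))) {P : Costed ((Fin N → ℝ) × (Fin N → ℝ))}
    (hP : IsAdmissible C r c ε P.val) {T : ℝ}
    (hT : P.ops + (18410 + 160 * q) * ((N : ℝ) ^ 2 * (√N * √(Real.log N) * maxAbs C / ε)) ≤ T) :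
    SolvesWithin C r c ε L₀ P T := by
  have hN1 : (2 : ℝ) ≤ N := by exact_mod_cast hN
  have hlog2 := Real.log_two_gt_d9
  have hlogN : Real.log 2 ≤ Real.log N := Real.log_le_log (by norm_num) hN1
  have hlog : 0 < Real.log N := by linarith
  have hγ : 0 < ε / (4 * Real.log N) := by positivity
  have hL0 : 0 < L₀ := lt_of_lt_of_le (by positivity) hL
  set Z := √N * √(Real.log N) * maxAbs C / ε with hZdef
  -- With Z ≥ 1 additive constants are absorbed; it holds because N ln N ≥ 2 ln 2 > 1.
  have hZ : 1 ≤ Z := by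
    have h1 : 1 ≤ √N * √(Real.log N) := by
      rw [← Real.sqrt_mul (by positivity), Real.one_le_sqrt]
      nlinarith
    rw [hZdef, mul_div_assoc]
    have h2 : 1 ≤ maxAbs C / ε := (one_le_div hε).2 hεM
    nlinarith
  set K := ⌈56 * Z⌉₊ with hKdef
  have hK : 56 * Z ≤ K := Nat.le_ceil _
  have hK2 : (K : ℝ) < 56 * Z + 1 := Nat.ceil_lt_add_one (by linarith)
  have hK0 : 0 < K := by
    have : (0 : ℝ) < K := by linarith
    exact_mod_cast this
  have hinit : LoopInvariant C P.val.1 P.val.2 (ε / (4 * Real.log N)) L₀ K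
      (Costed.setup ε L₀ P).val.2.2 0 0 :=
    ⟨⟨State.estimate_init _ _ _ _ hL0, State.growth_init hL'⟩, half_pos hL0, le_max_left _ _,
      by simp [Costed.setup, Costed.val_bind, Costed.val_pure, Costed.div], hK0⟩
  obtain ⟨X, t, hloop, hX, ht⟩ := Costed.exists_loopReturns
    (step := Costed.mainStep C r c ε (ε / (4 * Real.log N)) P.val.1 P.val.2)
    (Inv := fun z n => ∃ acc rej, n = acc + rej ∧
      LoopInvariant C P.val.1 P.val.2 (ε / (4 * Real.log N)) L₀ K z acc rej)
    (Q := IsApproxPlan C r c ε) (M := 53 * (N * N) + 54 * N + 50) (B := 2 * K + q)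
    (by
      rintro z n ⟨acc, rej, rfl, hz⟩
      have h1 := hz.rej_le hγ hθ hL hq
      have h2 := hz.acc_lt
      omega)
    Costed.ops_mainStep
    (by
      rintro z n ⟨acc, rej, rfl, hz⟩
      rcases mainStep_spec hN hC hr hc hε hεM hP hK hz with h | ⟨z', hz', h | h⟩
      · exact Or.inl h
      · exact Or.inr ⟨z', hz', acc + 1, rej, by omega, h⟩
      · exact Or.inr ⟨z', hz', acc, rej + 1, by omega, h⟩)
    _ 0 ⟨0, 0, rfl, hinit⟩
  refine ⟨X, _, ⟨t, hloop, rfl⟩, hX, le_trans ?_ hT⟩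
  have hops : (Costed.setup ε L₀ P).ops = P.ops + 4 := by
    change 3 + (P.ops + (1 + 0)) = _
    omega
  have ht2 : (t : ℝ) ≤ 160 * (N : ℝ) ^ 2 * (2 * K + q + 1) := by
    have h1 : (t : ℝ) ≤ (53 * (N * N) + 54 * N + 50) * (2 * K + q + 1) := by
      rw [Nat.sub_zero] at ht
      exact_mod_cast ht
    refine h1.trans (mul_le_mul_of_nonneg_right ?_ (by positivity))
    nlinarith
  -- 2K + 1 < 112 Z + 3 ≤ 115 Z, and 160 · 115 = 18400; the slack up to 18410 pays for the setup.
  have h3 : 160 * (N : ℝ) ^ 2 * (2 * K + q + 1)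
      ≤ 160 * (N : ℝ) ^ 2 * ((115 + q) * Z) := by
    refine mul_le_mul_of_nonneg_left ?_ (by positivity)
    have : (0 : ℝ) ≤ q := q.cast_nonneg
    nlinarith
  have h4 : 4 ≤ 4 * ((N : ℝ) ^ 2 * Z) := by
    have : (1 : ℝ) ≤ N ^ 2 := by nlinarith
    nlinarith
  rw [hops]
  push_cast
  have h5 : 0 ≤ (N : ℝ) ^ 2 * Z := by positivity
  nlinarith

theorem rpow_five_halves (N : ℕ) : (N : ℝ) ^ (5 / 2 : ℝ) = (N : ℝ) ^ 2 * √N := by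
  rcases Nat.eq_zero_or_pos N with rfl | hN
  · norm_num
  · have h : (0 : ℝ) < N := by exact_mod_cast hN
    rw [Real.sqrt_eq_rpow, ← Real.rpow_natCast, ← Real.rpow_add h]
    norm_num

end Complexity

end AccSinkhorn
end

/-! ### Assembly of rates and complexity -/

theorem mainTheorem3 :
    (∀ (N : ℕ) (C : Matrix (Fin N) (Fin N) ℝ) (r c : Fin N → ℝ) (γ L₀ : ℝ),
      (∀ i j, 0 ≤ C i j) → AccSinkhorn.IsHistogram r → AccSinkhorn.IsHistogram c →
      (∀ i, 0 < r i) → (∀ j, 0 < c j) → 0 < γ → 0 < L₀ → L₀ ≤ 16 * γ →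
      (∃ s : ℕ → AccSinkhorn.State N, AccSinkhorn.IsRun C r c γ L₀ s) ∧
      ∃ Xopt : Matrix (Fin N) (Fin N) ℝ,
        (∀ Y, AccSinkhorn.IsRegSolution C r c γ Y ↔ Y = Xopt) ∧
        ∀ s : ℕ → AccSinkhorn.State N, AccSinkhorn.IsRun C r c γ L₀ s → ∀ k : ℕ, 1 ≤ k →
          ‖AccSinkhorn.marginals (s k).xhat - AccSinkhorn.mkDual r c‖ ≤
            64 * √((N : ℝ) / 2) *
              (AccSinkhorn.maxAbs C - γ / 2 * Real.log (AccSinkhorn.minEntry r c)) /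
              (γ * (k : ℝ) ^ 2) ∧
          |AccSinkhorn.dualObj C r c γ (s k).η + AccSinkhorn.regObj C γ (s k).xhat| ≤
            32 * (N : ℝ) *
              (AccSinkhorn.maxAbs C - γ / 2 * Real.log (AccSinkhorn.minEntry r c)) ^ 2 /
              (γ * (k : ℝ) ^ 2) ∧
          AccSinkhorn.l1Norm ((s k).xhat - Xopt) ≤
            16 * √((N : ℝ) / 2) *
              (AccSinkhorn.maxAbs C - γ / 2 * Real.log (AccSinkhorn.minEntry r c)) /
              (γ * (k : ℝ))) ∧
    (∀ θ : ℝ, 0 < θ → ∃ K : ℝ, 0 < K ∧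
      ∀ (N : ℕ) (C : Matrix (Fin N) (Fin N) ℝ) (r c : Fin N → ℝ) (ε L₀ : ℝ),
        2 ≤ N → (∀ i j, 0 ≤ C i j) → AccSinkhorn.IsHistogram r → AccSinkhorn.IsHistogram c →
        0 < ε → ε ≤ AccSinkhorn.maxAbs C →
        θ * (ε / (4 * Real.log N)) ≤ L₀ → L₀ ≤ 16 * (ε / (4 * Real.log N)) →
        AccSinkhorn.IsAdmissible C r c ε (AccSinkhorn.Costed.perturb C r c ε).val ∧
        AccSinkhorn.SolvesWithin C r c ε L₀ (AccSinkhorn.Costed.perturb C r c ε)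
          (K * ((N : ℝ) ^ (5 / 2 : ℝ) * √(Real.log N) * AccSinkhorn.maxAbs C / ε)) ∧
        ∀ P : AccSinkhorn.Costed ((Fin N → ℝ) × (Fin N → ℝ)),
          AccSinkhorn.IsAdmissible C r c ε P.val →
          AccSinkhorn.SolvesWithin C r c ε L₀ P
            (P.ops + K * ((N : ℝ) ^ (5 / 2 : ℝ) * √(Real.log N) * AccSinkhorn.maxAbs C / ε))) := by
  refine ⟨?_, fun θ hθ => ?_⟩
  · intro N C r c γ L₀ hC hr hc hr0 hc0 hγ hL hL'
    have : NeZero N := ⟨by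
      rintro rfl
      simpa using hr.2⟩
    exact AccSinkhorn.convergence_rates hγ hC hr hc hr0 hc0 hL hL'
  · obtain ⟨q, hq⟩ := pow_unbounded_of_one_lt (16 / θ) (one_lt_two (α := ℝ))
    -- The additional 20 N² covers the 2N² + 4N + 7 operations of the explicit perturbation.
    refine ⟨18430 + 160 * q, by positivity, ?_⟩
    intro N C r c ε L₀ hN hC hr hc hε hεM hL hL'
    have hadm := AccSinkhorn.isAdmissible_perturb hN hr hc hε hεM
    have e : (N : ℝ) ^ (5 / 2 : ℝ) * √(Real.log N) * AccSinkhorn.maxAbs C / ε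
        = (N : ℝ) ^ 2 * (√N * √(Real.log N) * AccSinkhorn.maxAbs C / ε) := by
      rw [AccSinkhorn.rpow_five_halves]
      ring
    have hN1 : (2 : ℝ) ≤ N := by exact_mod_cast hN
    have hlog : Real.log 2 ≤ Real.log N := Real.log_le_log (by norm_num) hN1
    have hZ : 1 ≤ √N * √(Real.log N) * AccSinkhorn.maxAbs C / ε := by
      have h1 : 1 ≤ √N * √(Real.log N) := by
        rw [← Real.sqrt_mul (by positivity), Real.one_le_sqrt]
        nlinarith [Real.log_two_gt_d9]
      rw [mul_div_assoc]
      have h2 : 1 ≤ AccSinkhorn.maxAbs C / ε := (one_le_div hε).2 hεM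
      nlinarith
    rw [e]
    refine ⟨hadm, ?_, fun P hP => ?_⟩
    · refine AccSinkhorn.solvesWithin hN hC hr hc hε hεM hθ hq hL hL' hadm ?_
      rw [AccSinkhorn.Costed.ops_perturb]
      push_cast
      have h3 : (N : ℝ) ^ 2 ≤ N ^ 2 * (√N * √(Real.log N) * AccSinkhorn.maxAbs C / ε) :=
        le_mul_of_one_le_right (by positivity) hZ
      nlinarith
    · refine AccSinkhorn.solvesWithin hN hC hr hc hε hεM hθ hq hL hL' hP ?_
      have h4 : (0 : ℝ) ≤ N ^ 2 * (√N * √(Real.log N) * AccSinkhorn.maxAbs C / ε) := by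
        positivity
      linarith
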